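/- Let $A$ and $B$ be (complex, not necessarily unital) $C^*$-algebras. A *right-Hilbert $A$–$B$ bimodule* is a Hilbert $B$-module $X$ (a right $B$-module with a positive definite $B$-valued inner product $\langle\cdot,\cdot\rangle_B$, linear in the second variable, complete in the norm $\|\langle x,x\rangle_B\|^{1/2}$) which is full ($\langle X,X\rangle_B$ spans a dense subspace of $B$), together with a nondegenerate left action of $A$ ($A\cdot X$ spans a dense subspace of $X$) satisfying $a\cdot(x\cdot b)=(a\cdot x)\cdot b$ and $\langle a\cdot x,y\rangle_B=\langle x,a^*\cdot y\rangle_B$. Let $\mathcal C$ be the category whose objects are $C^*$-algebras, whose morphisms $A\to B$ are the isomorphism classes $[{}_AX_B]$ of right-Hilbert $A$–$B$ bimodules (isomorphisms being linear bijections preserving both actions and the inner product), and in which the composition $[{}_BY_D]\circ[{}_AX_B]$ is the class of the internal tensor product $X\otimes_BY$. For a homomorphism $\phi\colon A\to M(C)$ into the multiplier algebra of a $C^*$-algebra $C$ that is nondegenerate ($\phi(A)C$ spans a dense subspace of $C$), let $[\phi]\colon A\to C$ be the class of the bimodule $C$ with $a\cdot c=\phi(a)c$, $c\cdot d=cd$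 and $\langle c,d\rangle_C=c^*d$. A right-Hilbert $C$–$B$ bimodule $Y$ is an *imprimitivity bimodule* if it is also a full left Hilbert $C$-module, with inner product ${}_C\langle\cdot,\cdot\rangle$, such that ${}_C\langle x,y\rangle\cdot z=x\cdot\langle y,z\rangle_B$ and ${}_C\langle x\cdot b,y\rangle={}_C\langle x,y\cdot b^*\rangle$. **Proposition.** For every morphism $[{}_AX_B]$ in $\mathcal C$ there exist a $C^*$-algebra $C$, a nondegenerate homomorphism $\phi\colon A\to M(C)$ and a $C$–$B$ imprimitivity bimodule ${}_CY_B$ such that $$[{}_AX_B]=[{}_CY_B]\circ[\phi]\quad\text{in }\mathcal C,$$ in other words, such that ${}_AX_B\cong{}_A(C\otimes_CY)_B$ as right-Hilbert bimodules, where $A$ acts on $C$ through $\phi$. Moreover, one can take $C=\mathcal K(X_B)$, the $C^*$-algebra of compact operators on $X_B$, i.e. the closed linear span of the operators $\Theta_{x,y}\colon z\mapsto x\cdot\langle y,z\rangle_B$ in the $C^*$-algebra $\mathcal L(X_B)$ of adjointable operators on $X_B$. -/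

import Mathlib

universe u v w u' w'

/-! ### Hilbert modules -/

/-- A right module `E` over a C⋆-algebra `B` with a `B`-valued form, conjugate-linear in the first
and linear in the second variable, which is positive (elements of the form `b⋆b` are the positive
elements of `B`) but possibly degenerate.  Mathlib's `CStarModule` is for left actions
(`⟪x, a • y⟫ = a * ⟪x, y⟫`), so that right modules are set up here. -/
structure SemiHilbertForm (B : Type*) [NonUnitalCStarAlgebra B] (E : Type*) [AddCommGroup E]
    [Module ℂ E] where
  /-- the right action, `ract x b = x · b` -/
  ract : E →ₗ[ℂ] B →ₗ[ℂ] E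
  /-- the `B`-valued form `⟨x, y⟩_B` -/
  ip : E →ₗ⋆[ℂ] E →ₗ[ℂ] B
  ract_mul : ∀ x b c, ract x (b * c) = ract (ract x b) c
  ip_ract : ∀ x y b, ip x (ract y b) = ip x y * b
  star_ip : ∀ x y, star (ip x y) = ip y x
  ip_self_pos : ∀ x, ∃ b, ip x x = star b * b

namespace SemiHilbertForm

variable {B : Type*} [NonUnitalCStarAlgebra B] {E : Type*} [AddCommGroup E] [Module ℂ E]
  (P : SemiHilbertForm B E)

theorem ract_ip (x y : E) (b : B) : P.ip (P.ract x b) y = star b * P.ip x y := by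
  rw [← P.star_ip, P.ip_ract, star_mul, P.star_ip]

/-- The Cauchy–Schwarz inequality. -/
theorem cauchy_schwarz (x y : E) : ‖P.ip x y‖ ^ 2 ≤ ‖P.ip x x‖ * ‖P.ip y y‖ := by
  let _ := CStarAlgebra.spectralOrder B
  have _ := CStarAlgebra.spectralOrderedRing B
  have key : ∀ r : ℝ, 0 < r → ‖P.ip x x‖ ≤ r → ‖P.ip x y‖ ^ 2 ≤ r * ‖P.ip y y‖ := by
    intro r hr hxr
    set b := P.ip x y with hb
    have hbs : P.ip y x = star b := (P.star_ip x y).symm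
    have h0 : 0 ≤ star b * P.ip x x * b - r • (star b * b) - r • (star b * b)
        + r • (r • P.ip y y) := by
      obtain ⟨c, hc⟩ := P.ip_self_pos (P.ract x b - (r : ℂ) • y)
      have : 0 ≤ P.ip (P.ract x b - (r : ℂ) • y) (P.ract x b - (r : ℂ) • y) := by
        rw [hc]; exact star_mul_self_nonneg c
      refine this.trans_eq ?_
      simp only [map_sub, map_smulₛₗ, LinearMap.sub_apply, LinearMap.smul_apply, P.ip_ract,
        P.ract_ip, hbs, ← hb, RingHom.id_apply, Complex.conj_ofReal, smul_sub, mul_assoc]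
      simp only [Complex.coe_smul]
      abel
    have h1 : star b * P.ip x x * b ≤ r • (star b * b) := by
      obtain ⟨c, hc⟩ := P.ip_self_pos x
      have h := CStarAlgebra.star_left_conjugate_le_norm_smul (a := b) (b := P.ip x x)
        (P.star_ip x x)
      refine h.trans ?_
      exact smul_le_smul_of_nonneg_right hxr (star_mul_self_nonneg b)
    have h2 : star b * b ≤ r • P.ip y y := by
      have h3 : 0 ≤ r • (r • P.ip y y - star b * b) := by
        refine h0.trans ?_
        have : star b * P.ip x x * b - r • (star b * b) - r • (star b * b) + r • (r • P.ip y y)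
          ≤ r • (star b * b) - r • (star b * b) - r • (star b * b) + r • (r • P.ip y y) := by
          gcongr
        refine this.trans_eq ?_
        rw [smul_sub]; abel
      have h4 := smul_nonneg (inv_nonneg.2 hr.le) h3
      rw [smul_smul, inv_mul_cancel₀ hr.ne', one_smul] at h4
      exact sub_nonneg.1 h4
    have h5 := CStarAlgebra.norm_le_norm_of_nonneg_of_le (star_mul_self_nonneg b) h2
    rwa [CStarRing.norm_star_mul_self, norm_smul, Real.norm_of_nonneg hr.le, ← sq] at h5
  refine le_of_forall_pos_le_add fun ε hε => ?_
  have hd : 0 < ‖P.ip y y‖ + 1 := by positivity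
  have := key (‖P.ip x x‖ + ε / (‖P.ip y y‖ + 1)) (by positivity)
    (by simp only [le_add_iff_nonneg_right]; positivity)
  refine this.trans ?_
  rw [add_mul]
  gcongr
  rw [div_mul_eq_mul_div, div_le_iff₀ hd]
  nlinarith

/-- The seminorm `‖x‖ = ‖⟨x, x⟩‖^{1/2}`. -/
noncomputable def seminorm : Seminorm ℂ E :=
  Seminorm.of (fun x => √‖P.ip x x‖)
    (fun x y => by
      refine Real.sqrt_le_iff.2 ⟨by positivity, ?_⟩
      have h1 : ‖P.ip x y‖ ≤ √‖P.ip x x‖ * √‖P.ip y y‖ := by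
        rw [← Real.sqrt_mul (norm_nonneg _)]
        exact Real.le_sqrt_of_sq_le (P.cauchy_schwarz x y)
      have h2 : ‖P.ip y x‖ ≤ √‖P.ip x x‖ * √‖P.ip y y‖ := by
        rwa [← P.star_ip, norm_star]
      have h3 : ‖P.ip (x + y) (x + y)‖ ≤ ‖P.ip x x‖ + ‖P.ip x y‖ + ‖P.ip y x‖ + ‖P.ip y y‖ := by
        simp only [map_add, LinearMap.add_apply]
        refine le_trans (le_of_eq ?_) (norm_add₄_le (a := P.ip x x) (b := P.ip x y)
          (c := P.ip y x) (d := P.ip y y))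
        congr 1; abel
      have h4 := Real.sq_sqrt (norm_nonneg (P.ip x x))
      have h5 := Real.sq_sqrt (norm_nonneg (P.ip y y))
      nlinarith)
    (fun c x => by
      simp only [map_smulₛₗ, LinearMap.smul_apply, RingHom.id_apply, norm_smul, RCLike.norm_conj]
      rw [← mul_assoc, Real.sqrt_mul (by positivity), Real.sqrt_mul_self (norm_nonneg _)])

theorem seminorm_apply (x : E) : P.seminorm x = √‖P.ip x x‖ := rfl

theorem seminorm_sq (x : E) : P.seminorm x ^ 2 = ‖P.ip x x‖ := Real.sq_sqrt (norm_nonneg _)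

theorem norm_ip_le (x y : E) : ‖P.ip x y‖ ≤ P.seminorm x * P.seminorm y := by
  rw [seminorm_apply, seminorm_apply, ← Real.sqrt_mul (norm_nonneg _)]
  exact Real.le_sqrt_of_sq_le (P.cauchy_schwarz x y)

theorem seminorm_ract_le (x : E) (b : B) : P.seminorm (P.ract x b) ≤ P.seminorm x * ‖b‖ := by
  rw [seminorm_apply, P.ip_ract, P.ract_ip]
  refine Real.sqrt_le_iff.2 ⟨mul_nonneg (apply_nonneg _ _) (norm_nonneg _), ?_⟩
  rw [mul_pow, P.seminorm_sq]
  refine (norm_mul_le _ _).trans ?_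
  have := norm_mul_le (star b) (P.ip x x)
  rw [norm_star] at this
  nlinarith [norm_nonneg b]

/-- A ⋆-preserving action of a C⋆-algebra is contractive. -/
theorem seminorm_lact_le {A : Type*} [NonUnitalCStarAlgebra A] (l : A →ₗ[ℂ] E →ₗ[ℂ] E)
    (l_mul : ∀ a b x, l (a * b) x = l a (l b x))
    (ip_l : ∀ a x y, P.ip (l a x) y = P.ip x (l (star a) y)) (a : A) (x : E) :
    P.seminorm (l a x) ≤ ‖a‖ * P.seminorm x := by
  let _ := CStarAlgebra.spectralOrder A
  have _ := CStarAlgebra.spectralOrderedRing A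
  let _ := CStarAlgebra.spectralOrder B
  have _ := CStarAlgebra.spectralOrderedRing B
  have key : ∀ a : A, ‖a‖ < 1 → P.seminorm (l a x) ≤ P.seminorm x := by
    intro a ha
    obtain ⟨d, hd, hdd⟩ : ∃ d : A, star d = d ∧ star a * a = d + d - d * d := by
      have hsa : IsSelfAdjoint (star a * a) := IsSelfAdjoint.star_mul_self a
      have hf : Continuous (fun t : ℝ => 1 - √(1 - t)) := by fun_prop
      refine ⟨cfcₙ (fun t : ℝ => 1 - √(1 - t)) (star a * a),
        (cfcₙ_predicate (p := IsSelfAdjoint) _ (star a * a)).star_eq, ?_⟩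
      rw [← cfcₙ_mul _ _ _ hf.continuousOn (by simp) hf.continuousOn (by simp),
        ← cfcₙ_add _ _ _ hf.continuousOn (by simp) hf.continuousOn (by simp),
        ← cfcₙ_sub _ _ _ (by fun_prop) (by simp) (by fun_prop) (by simp)]
      conv_lhs => rw [← cfcₙ_id ℝ (star a * a)]
      refine cfcₙ_congr fun t ht => ?_
      have ht1 : t ≤ 1 := by
        have h1 := NonUnitalIsometricContinuousFunctionalCalculus.norm_quasispectrum_le (𝕜 := ℝ) (star a * a) ht
        rw [CStarRing.norm_star_mul_self] at h1
        have := le_abs_self t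
        rw [Real.norm_eq_abs] at h1
        nlinarith [norm_nonneg a]
      have := Real.mul_self_sqrt (sub_nonneg.2 ht1)
      simp only [id]
      nlinarith
    have h1 : P.ip (l a x) (l a x) = P.ip x x - P.ip (x - l d x) (x - l d x) := by
      rw [ip_l, ← l_mul, hdd]
      simp only [map_sub, map_add, LinearMap.sub_apply, LinearMap.add_apply, l_mul, ip_l, hd]
      abel
    have h2 : P.ip (l a x) (l a x) ≤ P.ip x x := by
      obtain ⟨c, hc⟩ := P.ip_self_pos (x - l d x)
      rw [h1, hc, sub_le_self_iff]
      exact star_mul_self_nonneg c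
    have h3 : 0 ≤ P.ip (l a x) (l a x) := by
      obtain ⟨c, hc⟩ := P.ip_self_pos (l a x)
      rw [hc]
      exact star_mul_self_nonneg c
    exact Real.sqrt_le_sqrt (CStarAlgebra.norm_le_norm_of_nonneg_of_le h3 h2)
  have key2 : ∀ r : ℝ, ‖a‖ < r → P.seminorm (l a x) ≤ r * P.seminorm x := by
    intro r hr
    have hr0 : 0 < r := (norm_nonneg a).trans_lt hr
    have h := key ((r⁻¹ : ℂ) • a) (by
      rw [norm_smul, norm_inv, Complex.norm_real, Real.norm_of_nonneg hr0.le, inv_mul_lt_iff₀ hr0]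
      linarith)
    rw [map_smul, LinearMap.smul_apply, map_smul_eq_mul, norm_inv, Complex.norm_real,
      Real.norm_of_nonneg hr0.le, inv_mul_le_iff₀ hr0] at h
    exact h
  refine le_of_forall_pos_le_add fun ε hε => ?_
  have hd : 0 < P.seminorm x + 1 := by linarith [apply_nonneg P.seminorm x]
  have := key2 (‖a‖ + ε / (P.seminorm x + 1)) (by simp only [lt_add_iff_pos_right]; positivity)
  refine this.trans ?_
  rw [add_mul]
  gcongr
  rw [div_mul_eq_mul_div, div_le_iff₀ hd]
  nlinarith

end SemiHilbertForm

/-- A Hilbert `B`-module: a right `B`-module with a positive definite `B`-valued inner product,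
complete in the norm `‖x‖ = ‖⟨x, x⟩_B‖^{1/2}`. -/
structure HilbertCModule (B : Type v) [NonUnitalCStarAlgebra B] : Type (max v (w + 1)) where
  carrier : Type w
  [normedAddCommGroup : NormedAddCommGroup carrier]
  [normedSpace : NormedSpace ℂ carrier]
  [completeSpace : CompleteSpace carrier]
  form : SemiHilbertForm B carrier
  norm_sq : ∀ x, ‖x‖ ^ 2 = ‖form.ip x x‖

attribute [instance] HilbertCModule.normedAddCommGroup HilbertCModule.normedSpace
  HilbertCModule.completeSpace

namespace HilbertCModule

instance {B : Type v} [NonUnitalCStarAlgebra B] :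
    CoeSort (HilbertCModule.{v, w} B) (Type w) := ⟨HilbertCModule.carrier⟩

variable {B : Type v} [NonUnitalCStarAlgebra B] (X : HilbertCModule.{v, w} B)

/-- the right action, `X.ract x b = x · b` -/
abbrev ract : X →ₗ[ℂ] B →ₗ[ℂ] X := X.form.ract

/-- the inner product `⟨x, y⟩_B` -/
abbrev ip : X →ₗ⋆[ℂ] X →ₗ[ℂ] B := X.form.ip

theorem seminorm_eq (x : X) : X.form.seminorm x = ‖x‖ := by
  rw [← sq_eq_sq₀ (apply_nonneg _ _) (norm_nonneg _), X.norm_sq, X.form.seminorm_sq]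

theorem norm_ip_le (x y : X) : ‖X.ip x y‖ ≤ ‖x‖ * ‖y‖ := by
  simpa only [X.seminorm_eq] using X.form.norm_ip_le x y

theorem norm_ract_le (x : X) (b : B) : ‖X.ract x b‖ ≤ ‖x‖ * ‖b‖ := by
  simpa only [X.seminorm_eq] using X.form.seminorm_ract_le x b

theorem eq_zero_of_ip {x : X} (h : X.ip x x = 0) : x = 0 := by
  have := X.norm_sq x
  change _ = ‖X.ip x x‖ at this
  rw [h, norm_zero] at this
  exact norm_eq_zero.1 (pow_eq_zero_iff two_ne_zero |>.1 this)

theorem ext_ip {x y : X} (h : ∀ z, X.ip z x = X.ip z y) : x = y :=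
  sub_eq_zero.1 <| X.eq_zero_of_ip <| by rw [map_sub, h, sub_self]

/-- the inner product as a continuous sesquilinear map -/
noncomputable def ipL : X →L⋆[ℂ] X →L[ℂ] B :=
  X.ip.mkContinuous₂ 1 fun x y => by simpa using X.norm_ip_le x y

/-- the right action as a continuous bilinear map -/
noncomputable def ractL : X →L[ℂ] B →L[ℂ] X :=
  X.ract.mkContinuous₂ 1 fun x b => by simpa using X.norm_ract_le x b

theorem ipL_apply (x y : X) : X.ipL x y = X.ip x y := rfl

theorem ractL_apply (x : X) (b : B) : X.ractL x b = X.ract x b := rfl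

@[fun_prop]
theorem continuous_ip {T : Type*} [TopologicalSpace T] {f g : T → X} (hf : Continuous f)
    (hg : Continuous g) : Continuous fun t => X.ip (f t) (g t) :=
  (X.ipL.continuous.comp hf).clm_apply hg

@[fun_prop]
theorem continuous_ract {T : Type*} [TopologicalSpace T] {f : T → X} {g : T → B}
    (hf : Continuous f) (hg : Continuous g) : Continuous fun t => X.ract (f t) (g t) :=
  (X.ractL.continuous.comp hf).clm_apply hg

end HilbertCModule

/-! ### Completion of a semi-definite module -/

namespace SemiHilbertForm

variable {B : Type v} [NonUnitalCStarAlgebra B] {E : Type w} [AddCommGroup E] [Module ℂ E]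
  (P : SemiHilbertForm B E)

/-- The space `E` with the seminorm `‖⟨x, x⟩‖^{1/2}`. -/
def Space (_P : SemiHilbertForm B E) : Type w := E

noncomputable instance : SeminormedAddCommGroup P.Space :=
  P.seminorm.toAddGroupSeminorm.toSeminormedAddCommGroup

noncomputable instance : NormedSpace ℂ P.Space where
  toModule := inferInstanceAs (Module ℂ E)
  norm_smul_le c x := (map_smul_eq_mul P.seminorm c x).le

/-- Divide `E` by the elements of length `0` and complete. -/
abbrev Hat : Type w := UniformSpace.Completion P.Space

/-- the canonical map of `E` to its completion -/
noncomputable def emb : E →ₗ[ℂ] P.Hat :=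
  (UniformSpace.Completion.toComplL : P.Space →L[ℂ] P.Hat).toLinearMap

theorem norm_emb (x : E) : ‖P.emb x‖ = P.seminorm x :=
  UniformSpace.Completion.norm_coe (E := P.Space) x

theorem denseRange_emb : DenseRange P.emb :=
  UniformSpace.Completion.denseRange_coe (α := P.Space)

theorem hat_induction {p : P.Hat → Prop} (hp : IsClosed {z | p z}) (h : ∀ x, p (P.emb x)) (z) :
    p z :=
  P.denseRange_emb.induction_on z hp h

/-- the right action, extended to the completion -/
noncomputable def hatRact : P.Hat →L[ℂ] B →L[ℂ] P.Hat :=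
  LinearMap.extendOfNorm (F := B →L[ℂ] P.Hat)
    { toFun x := ((P.emb ∘ₗ P.ract x).mkContinuous (P.seminorm x) fun b => by
        simpa [norm_emb] using P.seminorm_ract_le x b)
      map_add' x y := by ext b; simp
      map_smul' c x := by ext b; simp } P.emb

theorem hatRact_emb (x : E) (b : B) : P.hatRact (P.emb x) b = P.emb (P.ract x b) := by
  rw [hatRact, LinearMap.extendOfNorm_eq P.denseRange_emb]
  · rfl
  · refine ⟨1, fun x => ?_⟩
    rw [one_mul, norm_emb]
    exact LinearMap.mkContinuous_norm_le _ (apply_nonneg _ _)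
      fun b => by simpa [norm_emb] using P.seminorm_ract_le x b

/-- the linear functional `⟨x, ·⟩`, extended to the completion -/
noncomputable def hatIpAux (x : E) : P.Hat →L[ℂ] B := (P.ip x).extendOfNorm P.emb

theorem norm_ip_le_emb (x y : E) : ‖P.ip x y‖ ≤ P.seminorm x * ‖P.emb y‖ := by
  rw [norm_emb]; exact P.norm_ip_le x y

theorem hatIpAux_emb (x y : E) : P.hatIpAux x (P.emb y) = P.ip x y :=
  LinearMap.extendOfNorm_eq P.denseRange_emb ⟨_, P.norm_ip_le_emb x⟩ y

/-- the form, extended to the completion -/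
noncomputable def hatIp : P.Hat →L⋆[ℂ] P.Hat →L[ℂ] B :=
  LinearMap.extendOfNorm (F := P.Hat →L[ℂ] B)
    { toFun := P.hatIpAux
      map_add' x y := by
        ext z
        refine P.hat_induction (isClosed_eq (by fun_prop) (by fun_prop)) (fun z => ?_) z
        simp [hatIpAux_emb]
      map_smul' c x := by
        ext z
        refine P.hat_induction (isClosed_eq (by fun_prop) (by fun_prop)) (fun z => ?_) z
        simp [hatIpAux_emb] } P.emb

theorem hatIp_emb (x y : E) : P.hatIp (P.emb x) (P.emb y) = P.ip x y := by
  rw [hatIp, LinearMap.extendOfNorm_eq P.denseRange_emb]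
  · exact P.hatIpAux_emb x y
  · refine ⟨1, fun x => ?_⟩
    rw [one_mul, norm_emb]
    exact LinearMap.opNorm_extendOfNorm_le P.denseRange_emb (apply_nonneg _ _)
      (P.norm_ip_le_emb x)

theorem isClosed_pos : IsClosed {a : B | ∃ b, a = star b * b} := by
  let _ := CStarAlgebra.spectralOrder B
  have _ := CStarAlgebra.spectralOrderedRing B
  simp only [← CStarAlgebra.nonneg_iff_eq_star_mul_self]
  exact isClosed_Ici

@[fun_prop]
theorem continuous_hatIp {T : Type*} [TopologicalSpace T] {f g : T → P.Hat} (hf : Continuous f)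
    (hg : Continuous g) : Continuous fun t => P.hatIp (f t) (g t) :=
  (P.hatIp.continuous.comp hf).clm_apply hg

@[fun_prop]
theorem continuous_hatRact {T : Type*} [TopologicalSpace T] {f : T → P.Hat} {g : T → B}
    (hf : Continuous f) (hg : Continuous g) : Continuous fun t => P.hatRact (f t) (g t) :=
  (P.hatRact.continuous.comp hf).clm_apply hg

/-- The completion of a semi-definite module is a Hilbert module. -/
noncomputable def completion : HilbertCModule.{v, w} B where
  carrier := P.Hat
  form :=
    { ract := (ContinuousLinearMap.coeLM ℂ) ∘ₗ P.hatRact.toLinearMap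
      ip := (ContinuousLinearMap.coeLM ℂ) ∘ₛₗ P.hatIp.toLinearMap
      ract_mul x b c := by
        refine P.hat_induction (p := fun x => P.hatRact x (b * c) = P.hatRact (P.hatRact x b) c)
          (isClosed_eq (by fun_prop) (by fun_prop)) (fun x => ?_) x
        simp only [hatRact_emb, P.ract_mul]
      ip_ract x y b := by
        refine P.hat_induction (p := fun x => P.hatIp x (P.hatRact y b) = P.hatIp x y * b)
          (isClosed_eq (by fun_prop) (by fun_prop)) (fun x => ?_) x
        refine P.hat_induction
          (p := fun y => P.hatIp (P.emb x) (P.hatRact y b) = P.hatIp (P.emb x) y * b)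
          (isClosed_eq (by fun_prop) (by fun_prop)) (fun y => ?_) y
        simp only [hatRact_emb, hatIp_emb, P.ip_ract]
      star_ip x y := by
        refine P.hat_induction (p := fun x => star (P.hatIp x y) = P.hatIp y x)
          (isClosed_eq (by fun_prop) (by fun_prop)) (fun x => ?_) x
        refine P.hat_induction (p := fun y => star (P.hatIp (P.emb x) y) = P.hatIp y (P.emb x))
          (isClosed_eq (by fun_prop) (by fun_prop)) (fun y => ?_) y
        simp only [hatIp_emb, P.star_ip]
      ip_self_pos x := by
        refine P.hat_induction (p := fun x => ∃ b, P.hatIp x x = star b * b)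
          (isClosed_pos.preimage (f := fun x => P.hatIp x x) (by fun_prop)) (fun x => ?_) x
        simp only [hatIp_emb, P.ip_self_pos] }
  norm_sq x := by
    refine P.hat_induction (p := fun x => ‖x‖ ^ 2 = ‖P.hatIp x x‖)
      (isClosed_eq (by fun_prop) (by fun_prop)) (fun x => ?_) x
    rw [hatIp_emb, norm_emb, seminorm_sq]

section LeftAction

variable {A : Type u} [NonUnitalCStarAlgebra A] (l : A →ₗ[ℂ] E →ₗ[ℂ] E)
  (hl : ∀ a x, P.seminorm (l a x) ≤ ‖a‖ * P.seminorm x)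

/-- a bounded operator, extended to the completion -/
noncomputable def hatLactAux (a : A) : P.Hat →L[ℂ] P.Hat := (P.emb ∘ₗ l a).extendOfNorm P.emb

theorem hatLactAux_emb (l : A →ₗ[ℂ] E →ₗ[ℂ] E)
    (h : ∀ a x, P.seminorm (l a x) ≤ ‖a‖ * P.seminorm x) (a : A) (x : E) :
    P.hatLactAux l a (P.emb x) = P.emb (l a x) :=
  LinearMap.extendOfNorm_eq P.denseRange_emb
    ⟨‖a‖, fun x => by rw [norm_emb, LinearMap.comp_apply, norm_emb]; exact h a x⟩ x

/-- a left action, extended to the completion -/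
noncomputable def hatLact : A →ₗ[ℂ] P.Hat →ₗ[ℂ] P.Hat where
  toFun a := (P.hatLactAux l a).toLinearMap
  map_add' a b := by
    ext z
    refine P.hat_induction
      (p := fun z => P.hatLactAux l (a + b) z = P.hatLactAux l a z + P.hatLactAux l b z)
      (isClosed_eq (by fun_prop) (by fun_prop)) (fun t => ?_) z
    simp only [P.hatLactAux_emb l hl, map_add, LinearMap.add_apply]
  map_smul' r a := by
    ext z
    refine P.hat_induction (p := fun z => P.hatLactAux l (r • a) z = r • P.hatLactAux l a z)
      (isClosed_eq (P.hatLactAux l (r • a)).continuous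
        ((P.hatLactAux l a).continuous.const_smul r)) (fun t => ?_) z
    simp only [P.hatLactAux_emb l hl, map_smul, LinearMap.smul_apply]

theorem hatLact_emb (a : A) (x : E) : P.hatLact l hl a (P.emb x) = P.emb (l a x) :=
  P.hatLactAux_emb l hl a x

@[fun_prop]
theorem continuous_hatLact (a : A) : Continuous (P.hatLact l hl a) :=
  (P.hatLactAux l a).continuous

theorem hatLact_mul (h : ∀ a b x, l (a * b) x = l a (l b x)) (a b : A) (z : P.Hat) :
    P.hatLact l hl (a * b) z = P.hatLact l hl a (P.hatLact l hl b z) := by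
  refine P.hat_induction
    (p := fun z => P.hatLact l hl (a * b) z = P.hatLact l hl a (P.hatLact l hl b z))
    (isClosed_eq (P.continuous_hatLact l hl _)
      ((P.continuous_hatLact l hl _).comp (P.continuous_hatLact l hl _))) (fun t => ?_) z
  simp only [hatLact_emb, h]

theorem hatLact_ract (h : ∀ a x b, l a (P.ract x b) = P.ract (l a x) b) (a : A) (z : P.Hat)
    (b : B) : P.hatLact l hl a (P.hatRact z b) = P.hatRact (P.hatLact l hl a z) b := by
  refine P.hat_induction
    (p := fun z => P.hatLact l hl a (P.hatRact z b) = P.hatRact (P.hatLact l hl a z) b)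
    (isClosed_eq ((P.continuous_hatLact l hl _).comp (by fun_prop))
      (P.continuous_hatRact (P.continuous_hatLact l hl _) continuous_const)) (fun t => ?_) z
  simp only [hatLact_emb, hatRact_emb, h]

theorem hatIp_hatLact (h : ∀ a x y, P.ip (l a x) y = P.ip x (l (star a) y)) (a : A)
    (z z' : P.Hat) : P.hatIp (P.hatLact l hl a z) z' = P.hatIp z (P.hatLact l hl (star a) z') := by
  refine P.hat_induction
    (p := fun z => P.hatIp (P.hatLact l hl a z) z' = P.hatIp z (P.hatLact l hl (star a) z'))
    (isClosed_eq (P.continuous_hatIp (P.continuous_hatLact l hl _) continuous_const)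
      (P.continuous_hatIp continuous_id continuous_const)) (fun s => ?_) z
  refine P.hat_induction
    (p := fun z' => P.hatIp (P.hatLact l hl a (P.emb s)) z' =
      P.hatIp (P.emb s) (P.hatLact l hl (star a) z'))
    (isClosed_eq (P.continuous_hatIp continuous_const continuous_id)
      (P.continuous_hatIp continuous_const (P.continuous_hatLact l hl _))) (fun t => ?_) z'
  simp only [hatLact_emb, hatIp_emb, h]

end LeftAction

end SemiHilbertForm

theorem mem_of_dense_span {E F : Type*} [NormedAddCommGroup E] [NormedSpace ℂ E]
    [NormedAddCommGroup F] [NormedSpace ℂ F] {S : Set E}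
    (hS : Dense (Submodule.span ℂ S : Set E)) (f : E →L[ℂ] F) (K : Submodule ℂ F)
    (hK : IsClosed (K : Set F)) (h : ∀ x ∈ S, f x ∈ K) (x : E) : f x ∈ K := by
  have h1 : (Submodule.span ℂ S : Set E) ⊆ f ⁻¹' K :=
    Submodule.span_le (p := K.comap f.toLinearMap).2 h
  exact closure_minimal h1 (hK.preimage f.continuous) (hS x)

/-- A right-Hilbert `A`–`B` bimodule: a full Hilbert `B`-module with a nondegenerate left action
of `A` by adjointable operators. -/
structure RightHilbertBimodule (A : Type u) (B : Type v) [NonUnitalCStarAlgebra A]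
    [NonUnitalCStarAlgebra B] : Type (max u v (w + 1)) extends HilbertCModule.{v, w} B where
  /-- the left action, `lact a x = a · x` -/
  lact : A →ₗ[ℂ] carrier →ₗ[ℂ] carrier
  lact_mul : ∀ a b x, lact (a * b) x = lact a (lact b x)
  lact_ract : ∀ a x b, lact a (form.ract x b) = form.ract (lact a x) b
  ip_lact : ∀ a x y, form.ip (lact a x) y = form.ip x (lact (star a) y)
  full : Dense (Submodule.span ℂ {b | ∃ x y, form.ip x y = b} : Set B)
  nondegenerate : Dense (Submodule.span ℂ {z | ∃ a x, lact a x = z} : Set carrier)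

namespace RightHilbertBimodule

variable {A : Type u} {B : Type v} {C : Type u'} [NonUnitalCStarAlgebra A]
  [NonUnitalCStarAlgebra B] [NonUnitalCStarAlgebra C]

theorem norm_lact_le (X : RightHilbertBimodule.{u, v, w} A B) (a : A) (x : X.carrier) :
    ‖X.lact a x‖ ≤ ‖a‖ * ‖x‖ := by
  simpa only [X.toHilbertCModule.seminorm_eq] using
    X.form.seminorm_lact_le X.lact X.lact_mul X.ip_lact a x

/-- the left action as a continuous bilinear map -/
noncomputable def lactL (X : RightHilbertBimodule.{u, v, w} A B) :
    A →L[ℂ] X.carrier →L[ℂ] X.carrier :=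
  X.lact.mkContinuous₂ 1 fun a x => by simpa using X.norm_lact_le a x

@[fun_prop]
theorem continuous_lact (X : RightHilbertBimodule.{u, v, w} A B) {T : Type*} [TopologicalSpace T]
    {f : T → A} {g : T → X.carrier} (hf : Continuous f) (hg : Continuous g) :
    Continuous fun t => X.lact (f t) (g t) :=
  (X.lactL.continuous.comp hf).clm_apply hg

/-! ### The internal tensor product -/

section Tensor

variable (X : RightHilbertBimodule.{u, v, w} A B) (Y : RightHilbertBimodule.{v, u', w'} B C)

open scoped TensorProduct

/-- the form on the algebraic tensor product `X ⊙ Y` with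
`⟨x ⊗ y, z ⊗ w⟩ = ⟨y, ⟨x, z⟩ · w⟩` -/
noncomputable def tensorIp :
    X.carrier ⊗[ℂ] Y.carrier →ₗ⋆[ℂ] X.carrier ⊗[ℂ] Y.carrier →ₗ[ℂ] C :=
  TensorProduct.lift <| LinearMap.mk₂'ₛₗ (starRingEnd ℂ) (starRingEnd ℂ)
    (fun x y => TensorProduct.lift
      (LinearMap.mk₂ ℂ (fun z w => Y.form.ip y (Y.lact (X.form.ip x z) w))
        (by intros; simp) (by intros; simp) (by intros; simp) (by intros; simp)))
    (by intros; ext; simp) (by intros; ext; simp) (by intros; ext; simp) (by intros; ext; simp)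

theorem tensorIp_tmul (x z : X.carrier) (y w : Y.carrier) :
    tensorIp X Y (x ⊗ₜ y) (z ⊗ₜ w) = Y.form.ip y (Y.lact (X.form.ip x z) w) := rfl

/-- A self-adjoint element is positive, or else its negative part is detected by conjugation. -/
theorem exists_conj_eq_neg {M : Type*} [NonUnitalCStarAlgebra M] {T : M} (hT : IsSelfAdjoint T) :
    ∃ N S : M, star N * T * N = -(star S * S) ∧ (S = 0 → ∃ R, T = star R * R) := by
  let _ := CStarAlgebra.spectralOrder M
  have _ := CStarAlgebra.spectralOrderedRing M
  set N := T⁻ with hN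
  have hNn : 0 ≤ N := CFC.negPart_nonneg T
  have hNs : star N = N := (IsSelfAdjoint.of_nonneg hNn).star_eq
  have hNT : star N * T * N = - (N * N * N) := by
    rw [hNs]
    conv_lhs => rw [← CFC.posPart_sub_negPart T hT]
    rw [mul_sub, CFC.negPart_mul_posPart, ← hN]
    simp [mul_assoc]
  obtain ⟨S, hS⟩ : ∃ S, N * N * N = star S * S := by
    refine CStarAlgebra.nonneg_iff_eq_star_mul_self.1 ?_
    conv_rhs => enter [1, 1]; rw [← hNs]
    exact star_left_conjugate_nonneg hNn N
  refine ⟨N, S, hNT.trans (by rw [hS]), fun hS0 => ?_⟩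
  have hN0 : N = 0 := by
    have h3 : N * N * N = 0 := by rw [hS, hS0, mul_zero]
    have h4 : star (N * N) * (N * N) = 0 := by
      rw [star_mul, hNs, ← mul_assoc, h3, zero_mul]
    have h5 := (CStarRing.star_mul_self_eq_zero_iff _).1 h4
    rw [← hNs] at h5
    conv at h5 => enter [1, 2]; rw [hNs]
    exact (CStarRing.star_mul_self_eq_zero_iff _).1 h5
  exact CStarAlgebra.nonneg_iff_eq_star_mul_self.1 ((CFC.negPart_eq_zero_iff T hT).1 hN0)

/-- The Gram matrix of a finite family in a Hilbert module is of the form `R⋆R`. -/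
theorem exists_gram (F : HilbertCModule.{v, w} B) {n : ℕ} (x : Fin n → F) :
    ∃ R : Fin n → Fin n → B, ∀ i j, F.ip (x i) (x j) = ∑ k, star (R k i) * R k j := by
  classical
  let _ := CStarAlgebra.spectralOrder B
  have _ := CStarAlgebra.spectralOrderedRing B
  let T : CStarMatrix (Fin n) (Fin n) B := CStarMatrix.ofMatrix fun i j => F.ip (x i) (x j)
  have hT : IsSelfAdjoint T := by
    ext i j
    exact F.form.star_ip (x j) (x i)
  obtain ⟨N, S, hNT, hpos⟩ := exists_conj_eq_neg hT
  suffices hS0 : S = 0 by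
    obtain ⟨R, hR⟩ := hpos hS0
    refine ⟨R, fun i j => ?_⟩
    have := congrFun (congrFun hR i) j
    rwa [CStarMatrix.mul_apply] at this
  ext i k
  have h1 : (star N * T * N) k k =
      F.ip (∑ i, F.ract (x i) (N i k)) (∑ i, F.ract (x i) (N i k)) := by
    simp only [CStarMatrix.mul_apply, map_sum, LinearMap.sum_apply, F.form.ip_ract,
      F.form.ract_ip, Finset.sum_mul]
    rfl
  have h2 : 0 ≤ (star N * T * N) k k := by
    rw [h1]
    obtain ⟨b, hb⟩ := F.form.ip_self_pos (∑ i, F.ract (x i) (N i k))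
    rw [hb]
    exact star_mul_self_nonneg b
  have h3 : (star N * T * N) k k = - ∑ j, star (S j k) * S j k := by
    rw [hNT]
    simp only [CStarMatrix.neg_apply, CStarMatrix.mul_apply]
    rfl
  have h4 : ∑ j, star (S j k) * S j k = 0 :=
    le_antisymm (by rw [h3] at h2; exact neg_nonneg.1 h2)
      (Finset.sum_nonneg fun j _ => star_mul_self_nonneg _)
  have h5 := (Finset.sum_eq_zero_iff_of_nonneg fun j _ => star_mul_self_nonneg (S j k)).1 h4 i
    (Finset.mem_univ i)
  exact CStarRing.star_mul_self_eq_zero_iff _ |>.1 h5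

/-- the algebraic tensor product `X ⊙ Y` as a semi-definite right `C`-module -/
noncomputable def tensorForm : SemiHilbertForm C (X.carrier ⊗[ℂ] Y.carrier) where
  ract := LinearMap.flip
    { toFun c := LinearMap.lTensor X.carrier (Y.form.ract.flip c)
      map_add' c d := by simp [LinearMap.lTensor_add]
      map_smul' r c := by simp [LinearMap.lTensor_smul] }
  ip := tensorIp X Y
  ract_mul t b c := by
    induction t with
    | zero => simp
    | add s t hs ht => simp only [map_add, LinearMap.add_apply, hs, ht]
    | tmul x y => simp [Y.form.ract_mul]
  ip_ract s t b := by
    induction s with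
    | zero => simp
    | add s s' hs ht => simp only [map_add, LinearMap.add_apply, hs, ht, add_mul]
    | tmul x y =>
      induction t with
      | zero => simp
      | add s s' hs ht => simp only [map_add, LinearMap.add_apply, hs, ht, add_mul]
      | tmul z w => simp [tensorIp_tmul, Y.lact_ract, Y.form.ip_ract]
  star_ip s t := by
    induction s with
    | zero => simp
    | add s s' hs ht => simp only [map_add, LinearMap.add_apply, hs, ht, star_add]
    | tmul x y =>
      induction t with
      | zero => simp
      | add s s' hs ht => simp only [map_add, LinearMap.add_apply, hs, ht, star_add]
      | tmul z w =>
        rw [tensorIp_tmul, tensorIp_tmul, Y.form.star_ip, Y.ip_lact, X.form.star_ip]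
  ip_self_pos t := by
    let _ := CStarAlgebra.spectralOrder C
    have _ := CStarAlgebra.spectralOrderedRing C
    rw [← CStarAlgebra.nonneg_iff_eq_star_mul_self]
    obtain ⟨n, x, y, rfl⟩ : ∃ (n : ℕ) (x : Fin n → X.carrier) (y : Fin n → Y.carrier),
        t = ∑ i, x i ⊗ₜ y i := by
      obtain ⟨S, hS⟩ := TensorProduct.exists_finset t
      refine ⟨S.card, fun i => (S.equivFin.symm i).1.1, fun i => (S.equivFin.symm i).1.2, ?_⟩
      rw [hS, ← Finset.sum_coe_sort]
      exact (Equiv.sum_comp S.equivFin.symm (fun p : S => p.1.1 ⊗ₜ[ℂ] p.1.2)).symm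
    obtain ⟨R, hR⟩ := exists_gram X.toHilbertCModule x
    have : tensorIp X Y (∑ i, x i ⊗ₜ y i) (∑ i, x i ⊗ₜ y i) =
        ∑ k, Y.form.ip (∑ i, Y.lact (R k i) (y i)) (∑ i, Y.lact (R k i) (y i)) := by
      have h1 : ∀ k i j, Y.form.ip (Y.lact (R k i) (y i)) (Y.lact (R k j) (y j)) =
          Y.form.ip (y i) (Y.lact (star (R k i) * R k j) (y j)) := fun k i j => by
        rw [Y.ip_lact, Y.lact_mul]
      simp only [map_sum, LinearMap.sum_apply, tensorIp_tmul, h1, hR]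
      rw [Finset.sum_comm_cycle]
    rw [this]
    refine Finset.sum_nonneg fun k _ => ?_
    obtain ⟨b, hb⟩ := Y.form.ip_self_pos (∑ i, Y.lact (R k i) (y i))
    rw [hb]
    exact star_mul_self_nonneg b

/-- the left action of `A` on `X ⊙ Y` -/
noncomputable def tensorLact :
    A →ₗ[ℂ] X.carrier ⊗[ℂ] Y.carrier →ₗ[ℂ] X.carrier ⊗[ℂ] Y.carrier where
  toFun a := LinearMap.rTensor Y.carrier (X.lact a)
  map_add' a b := by simp [LinearMap.rTensor_add]
  map_smul' r a := by simp [LinearMap.rTensor_smul]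

theorem tensorLact_tmul (a : A) (x : X.carrier) (y : Y.carrier) :
    tensorLact X Y a (x ⊗ₜ y) = X.lact a x ⊗ₜ y := rfl

theorem tensorLact_mul (a b : A) (t : X.carrier ⊗[ℂ] Y.carrier) :
    tensorLact X Y (a * b) t = tensorLact X Y a (tensorLact X Y b t) := by
  induction t with
  | zero => simp
  | add s t hs ht => simp only [map_add, hs, ht]
  | tmul x y => simp only [tensorLact_tmul, X.lact_mul]

theorem tensorLact_ract (a : A) (t : X.carrier ⊗[ℂ] Y.carrier) (c : C) :
    tensorLact X Y a ((tensorForm X Y).ract t c) =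
      (tensorForm X Y).ract (tensorLact X Y a t) c := by
  induction t with
  | zero => simp
  | add s t hs ht => simp only [map_add, LinearMap.add_apply, hs, ht]
  | tmul x y => rfl

theorem tensorIp_lact (a : A) (s t : X.carrier ⊗[ℂ] Y.carrier) :
    tensorIp X Y (tensorLact X Y a s) t = tensorIp X Y s (tensorLact X Y (star a) t) := by
  induction s with
  | zero => simp
  | add s s' hs ht => simp only [map_add, LinearMap.add_apply, hs, ht]
  | tmul x y =>
    induction t with
    | zero => simp
    | add s s' hs ht => simp only [map_add, hs, ht]
    | tmul z w => simp only [tensorIp_tmul, tensorLact_tmul, X.ip_lact]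

/-- the map `x ↦ x ⊗ y` to the completion -/
noncomputable def tmulLeft (y : Y.carrier) : X.carrier →L[ℂ] (tensorForm X Y).Hat :=
  LinearMap.mkContinuous ((tensorForm X Y).emb ∘ₗ (TensorProduct.mk ℂ X.carrier Y.carrier).flip y)
    ‖y‖ fun x => by
      change ‖(tensorForm X Y).emb (x ⊗ₜ y)‖ ≤ _
      rw [SemiHilbertForm.norm_emb]
      refine le_of_sq_le_sq ?_ (by positivity)
      rw [SemiHilbertForm.seminorm_sq, mul_pow, X.norm_sq]
      change ‖Y.form.ip y (Y.lact (X.form.ip x x) y)‖ ≤ _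
      refine (Y.norm_ip_le _ _).trans ?_
      have := Y.norm_lact_le (X.form.ip x x) y
      nlinarith [norm_nonneg y]

theorem tmulLeft_apply (x : X.carrier) (y : Y.carrier) :
    tmulLeft X Y y x = (tensorForm X Y).emb (x ⊗ₜ y) := rfl

theorem tensor_full :
    Dense (Submodule.span ℂ {c | ∃ s t, (tensorForm X Y).completion.form.ip s t = c} : Set C) := by
  set S := (Submodule.span ℂ {c | ∃ s t, (tensorForm X Y).completion.form.ip s t = c}) with hS
  have h1 : ∀ (y w : Y.carrier) (b : B), Y.form.ip y (Y.lact b w) ∈ S.topologicalClosure := by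
    intro y w b
    refine mem_of_dense_span X.full ((Y.ipL y).comp (Y.lactL.flip w)) S.topologicalClosure
      S.isClosed_topologicalClosure ?_ b
    rintro _ ⟨x, z, rfl⟩
    refine S.le_topologicalClosure (Submodule.subset_span
      ⟨(tensorForm X Y).emb (x ⊗ₜ y), (tensorForm X Y).emb (z ⊗ₜ w), ?_⟩)
    exact ((tensorForm X Y).hatIp_emb _ _).trans (tensorIp_tmul X Y x z y w)
  have h2 : ∀ y w : Y.carrier, Y.form.ip y w ∈ S.topologicalClosure := by
    intro y w
    refine mem_of_dense_span Y.nondegenerate (Y.ipL y) S.topologicalClosure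
      S.isClosed_topologicalClosure ?_ w
    rintro _ ⟨b, w, rfl⟩
    exact h1 y w b
  intro c
  refine mem_of_dense_span Y.full (ContinuousLinearMap.id ℂ C) S.topologicalClosure
    S.isClosed_topologicalClosure ?_ c
  rintro _ ⟨y, w, rfl⟩
  exact h2 y w

theorem seminorm_tensorLact_le (a : A) (t : X.carrier ⊗[ℂ] Y.carrier) :
    (tensorForm X Y).seminorm (tensorLact X Y a t) ≤ ‖a‖ * (tensorForm X Y).seminorm t :=
  (tensorForm X Y).seminorm_lact_le (tensorLact X Y) (tensorLact_mul X Y)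
    (tensorIp_lact X Y) a t

/-- the left action of `A` on the completion of `X ⊙ Y` -/
noncomputable def hatLact :
    A →ₗ[ℂ] (tensorForm X Y).Hat →ₗ[ℂ] (tensorForm X Y).Hat :=
  (tensorForm X Y).hatLact (tensorLact X Y) (seminorm_tensorLact_le X Y)

theorem hatLact_emb (a : A) (t : X.carrier ⊗[ℂ] Y.carrier) :
    hatLact X Y a ((tensorForm X Y).emb t) = (tensorForm X Y).emb (tensorLact X Y a t) :=
  (tensorForm X Y).hatLact_emb _ _ a t

theorem tensor_nondegenerate :
    Dense (Submodule.span ℂ {z | ∃ a x, hatLact X Y a x = z} : Set (tensorForm X Y).Hat) := by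
  set S := (Submodule.span ℂ {z | ∃ a x, hatLact X Y a x = z}) with hS
  intro z
  change z ∈ S.topologicalClosure
  refine (tensorForm X Y).hat_induction (p := fun z => z ∈ S.topologicalClosure)
    S.isClosed_topologicalClosure (fun t => ?_) z
  induction t with
  | zero => rw [map_zero]; exact zero_mem _
  | add s t hs ht => rw [map_add]; exact add_mem hs ht
  | tmul x y =>
    refine mem_of_dense_span X.nondegenerate (tmulLeft X Y y) S.topologicalClosure
      S.isClosed_topologicalClosure ?_ x
    rintro _ ⟨a, x, rfl⟩
    exact S.le_topologicalClosure (Submodule.subset_span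
      ⟨a, (tensorForm X Y).emb (x ⊗ₜ y), hatLact_emb X Y a (x ⊗ₜ y)⟩)

/-- The internal tensor product `X ⊗_B Y`: the completion of the algebraic tensor product, modulo
the elements of length `0`. -/
noncomputable def tensor : RightHilbertBimodule.{u, u', max w w'} A C where
  toHilbertCModule := (tensorForm X Y).completion
  lact := hatLact X Y
  lact_mul := (tensorForm X Y).hatLact_mul _ _ (tensorLact_mul X Y)
  lact_ract := (tensorForm X Y).hatLact_ract _ _ (tensorLact_ract X Y)
  ip_lact := (tensorForm X Y).hatIp_hatLact _ _ (tensorIp_lact X Y)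
  full := tensor_full X Y
  nondegenerate := tensor_nondegenerate X Y

end Tensor

end RightHilbertBimodule

namespace RightHilbertBimodule

variable {A : Type u} {B : Type v} {C : Type u'} [NonUnitalCStarAlgebra A]
  [NonUnitalCStarAlgebra B] [NonUnitalCStarAlgebra C]

/-- An isomorphism of right-Hilbert bimodules. -/
structure Iso (X : RightHilbertBimodule.{u, v, w} A B) (Y : RightHilbertBimodule.{u, v, w'} A B)
    extends X.carrier ≃ₗ[ℂ] Y.carrier where
  map_lact : ∀ a x, toFun (X.lact a x) = Y.lact a (toFun x)
  map_ract : ∀ x b, toFun (X.form.ract x b) = Y.form.ract (toFun x) b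
  map_ip : ∀ x y, Y.form.ip (toFun x) (toFun y) = X.form.ip x y

namespace Iso

/-- the identity -/
def refl (X : RightHilbertBimodule.{u, v, w} A B) : Iso X X where
  toLinearEquiv := LinearEquiv.refl ℂ X.carrier
  map_lact _ _ := rfl
  map_ract _ _ := rfl
  map_ip _ _ := rfl

/-- the inverse -/
def symm {X : RightHilbertBimodule.{u, v, w} A B} {Y : RightHilbertBimodule.{u, v, w'} A B}
    (f : Iso X Y) : Iso Y X where
  toLinearEquiv := f.toLinearEquiv.symm
  map_lact a y := f.toLinearEquiv.injective <| by
    have := f.map_lact a (f.toLinearEquiv.symm y)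
    exact (f.toLinearEquiv.apply_symm_apply _).trans
      (this.trans (congrArg _ (f.toLinearEquiv.apply_symm_apply y))).symm
  map_ract y b := f.toLinearEquiv.injective <| by
    have := f.map_ract (f.toLinearEquiv.symm y) b
    exact (f.toLinearEquiv.apply_symm_apply _).trans
      (this.trans (congrArg (Y.form.ract · b) (f.toLinearEquiv.apply_symm_apply y))).symm
  map_ip y z := by
    have := f.map_ip (f.toLinearEquiv.symm y) (f.toLinearEquiv.symm z)
    refine this.symm.trans ?_
    exact congrArg₂ (fun s t => Y.form.ip s t) (f.toLinearEquiv.apply_symm_apply y)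
      (f.toLinearEquiv.apply_symm_apply z)

/-- the composition -/
def trans {X Y Z : RightHilbertBimodule.{u, v, w} A B} (f : Iso X Y) (g : Iso Y Z) : Iso X Z where
  toLinearEquiv := f.toLinearEquiv.trans g.toLinearEquiv
  map_lact a x := (congrArg g.toFun (f.map_lact a x)).trans (g.map_lact a _)
  map_ract x b := (congrArg g.toFun (f.map_ract x b)).trans (g.map_ract _ b)
  map_ip x y := (g.map_ip _ _).trans (f.map_ip x y)

section Tensor

open scoped TensorProduct

variable {X X' : RightHilbertBimodule.{u, v, w} A B} {Y Y' : RightHilbertBimodule.{v, u', w'} B C}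
  (f : Iso X X') (g : Iso Y Y')

/-- `f ⊗ g` on the algebraic tensor product -/
noncomputable def tensorAlg : X.carrier ⊗[ℂ] Y.carrier ≃ₗ[ℂ] X'.carrier ⊗[ℂ] Y'.carrier :=
  TensorProduct.congr f.toLinearEquiv g.toLinearEquiv

theorem tensorAlg_tmul (x : X.carrier) (y : Y.carrier) :
    tensorAlg f g (x ⊗ₜ y) = f.toFun x ⊗ₜ g.toFun y := rfl

theorem tensorIp_tensorAlg (s t : X.carrier ⊗[ℂ] Y.carrier) :
    tensorIp X' Y' (tensorAlg f g s) (tensorAlg f g t) = tensorIp X Y s t := by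
  induction s with
  | zero => simp
  | add s s' hs ht => simp only [map_add, LinearMap.add_apply, hs, ht]
  | tmul x y =>
    induction t with
    | zero => simp
    | add s s' hs ht => simp only [map_add, hs, ht]
    | tmul z w => rw [tensorAlg_tmul, tensorAlg_tmul, tensorIp_tmul, tensorIp_tmul, f.map_ip,
        ← g.map_lact, g.map_ip]

theorem norm_emb_tensorAlg (s : X.carrier ⊗[ℂ] Y.carrier) :
    ‖(tensorForm X' Y').emb (tensorAlg f g s)‖ = ‖(tensorForm X Y).emb s‖ := by
  rw [SemiHilbertForm.norm_emb, SemiHilbertForm.norm_emb]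
  exact congrArg (fun c => √‖c‖) (tensorIp_tensorAlg f g s s)

/-- `f ⊗ g` on the completion -/
noncomputable def tensorHat : (tensorForm X Y).Hat ≃ₗᵢ[ℂ] (tensorForm X' Y').Hat :=
  (tensorAlg f g).extendOfIsometry (tensorForm X Y).emb (tensorForm X' Y').emb
    (tensorForm X Y).denseRange_emb (tensorForm X' Y').denseRange_emb (norm_emb_tensorAlg f g)

theorem tensorHat_emb (s : X.carrier ⊗[ℂ] Y.carrier) :
    tensorHat f g ((tensorForm X Y).emb s) = (tensorForm X' Y').emb (tensorAlg f g s) :=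
  LinearEquiv.extendOfIsometry_eq _ _ _ _ _ _ s

/-- the isomorphism `f ⊗ g` of internal tensor products -/
noncomputable def tensor : Iso (X.tensor Y) (X'.tensor Y') where
  toLinearEquiv := (tensorHat f g).toLinearEquiv
  map_lact a z := by
    refine (tensorForm X Y).hat_induction
      (p := fun z => tensorHat f g (hatLact X Y a z) = hatLact X' Y' a (tensorHat f g z))
      (isClosed_eq ((tensorHat f g).continuous.comp
        ((tensorForm X Y).continuous_hatLact _ _ a))
        (((tensorForm X' Y').continuous_hatLact _ _ a).comp (tensorHat f g).continuous))
      (fun s => ?_) z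
    rw [hatLact_emb, tensorHat_emb, tensorHat_emb, hatLact_emb]
    congr 1
    induction s with
    | zero => simp
    | add s s' hs ht => simp only [map_add, hs, ht]
    | tmul x y => rw [tensorLact_tmul, tensorAlg_tmul, tensorAlg_tmul, tensorLact_tmul, f.map_lact]
  map_ract z c := by
    refine (tensorForm X Y).hat_induction
      (p := fun z => tensorHat f g ((tensorForm X Y).hatRact z c) =
        (tensorForm X' Y').hatRact (tensorHat f g z) c)
      (isClosed_eq ((tensorHat f g).continuous.comp
        ((tensorForm X Y).continuous_hatRact continuous_id continuous_const))
        ((tensorForm X' Y').continuous_hatRact (tensorHat f g).continuous continuous_const))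
      (fun s => ?_) z
    rw [SemiHilbertForm.hatRact_emb, tensorHat_emb, tensorHat_emb, SemiHilbertForm.hatRact_emb]
    congr 1
    induction s with
    | zero => simp
    | add s s' hs ht => simp only [map_add, LinearMap.add_apply, hs, ht]
    | tmul x y =>
      change f.toFun x ⊗ₜ g.toFun (Y.form.ract y c) = f.toFun x ⊗ₜ Y'.form.ract (g.toFun y) c
      rw [g.map_ract]
  map_ip z z' := by
    refine (tensorForm X Y).hat_induction
      (p := fun z => (tensorForm X' Y').hatIp (tensorHat f g z) (tensorHat f g z') =
        (tensorForm X Y).hatIp z z')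
      (isClosed_eq ((tensorForm X' Y').continuous_hatIp (tensorHat f g).continuous
        continuous_const) ((tensorForm X Y).continuous_hatIp continuous_id continuous_const))
      (fun s => ?_) z
    refine (tensorForm X Y).hat_induction
      (p := fun z' => (tensorForm X' Y').hatIp (tensorHat f g ((tensorForm X Y).emb s))
        (tensorHat f g z') = (tensorForm X Y).hatIp ((tensorForm X Y).emb s) z')
      (isClosed_eq ((tensorForm X' Y').continuous_hatIp continuous_const
        (tensorHat f g).continuous)
        ((tensorForm X Y).continuous_hatIp continuous_const continuous_id))
      (fun t => ?_) z'
    rw [tensorHat_emb, tensorHat_emb, SemiHilbertForm.hatIp_emb, SemiHilbertForm.hatIp_emb]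
    exact tensorIp_tensorAlg f g s t

end Tensor

end Iso

variable (A B) in
/-- isomorphism as an equivalence relation -/
instance isoSetoid : Setoid (RightHilbertBimodule.{u, v, w} A B) where
  r X Y := Nonempty (Iso X Y)
  iseqv := ⟨fun X => ⟨Iso.refl X⟩, fun ⟨f⟩ => ⟨f.symm⟩, fun ⟨f⟩ ⟨g⟩ => ⟨f.trans g⟩⟩

end RightHilbertBimodule

/-- The morphisms from `A` to `B` in the category `𝒞`: isomorphism classes of right-Hilbert
`A`–`B` bimodules. -/
def CStarMor (A : Type u) (B : Type v) [NonUnitalCStarAlgebra A] [NonUnitalCStarAlgebra B] :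
    Type (max u v (w + 1)) :=
  Quotient (RightHilbertBimodule.isoSetoid.{u, v, w} A B)

namespace CStarMor

variable {A : Type u} {B : Type v} {C : Type u'} [NonUnitalCStarAlgebra A]
  [NonUnitalCStarAlgebra B] [NonUnitalCStarAlgebra C]

/-- the class `[X]` of a bimodule -/
def mk (X : RightHilbertBimodule.{u, v, w} A B) : CStarMor.{u, v, w} A B :=
  Quotient.mk _ X

/-- The composition `[Y] ∘ [X] = [X ⊗_B Y]`. -/
noncomputable def comp (g : CStarMor.{v, u', w'} B C) (f : CStarMor.{u, v, w} A B) :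
    CStarMor.{u, u', max w w'} A C :=
  Quotient.map₂ (fun Y X => X.tensor Y) (by
    rintro Y Y' ⟨g⟩ X X' ⟨f⟩
    exact ⟨f.tensor g⟩) g f

end CStarMor

/-! ### Adjointable and compact operators -/

namespace HilbertCModule

variable {B : Type v} [NonUnitalCStarAlgebra B] (X : HilbertCModule.{v, w} B)

/-- The algebra `ℒ(X_B)` of adjointable operators. -/
def adjointable : Subalgebra ℂ (X →L[ℂ] X) where
  carrier := {T | ∃ S : X →L[ℂ] X, ∀ x y, X.ip (T x) y = X.ip x (S y)}
  mul_mem' := by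
    rintro T T' ⟨S, hS⟩ ⟨S', hS'⟩
    exact ⟨S' * S, fun x y => (hS _ _).trans (hS' _ _)⟩
  add_mem' := by
    rintro T T' ⟨S, hS⟩ ⟨S', hS'⟩
    exact ⟨S + S', fun x y => by simp [← hS, ← hS']⟩
  algebraMap_mem' c := ⟨algebraMap ℂ _ (star c), fun x y => by
    simp [Algebra.algebraMap_eq_smul_one]⟩

/-- The adjoint of an adjointable operator. -/
noncomputable def adjOp (T : X.adjointable) : X →L[ℂ] X := T.2.choose

theorem ip_adjOp (T : X.adjointable) (x y : X) : X.ip (T.1 x) y = X.ip x (X.adjOp T y) :=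
  T.2.choose_spec x y

theorem adjOp_ip (T : X.adjointable) (x y : X) : X.ip (X.adjOp T x) y = X.ip x (T.1 y) := by
  rw [← X.form.star_ip, ← X.ip_adjOp, X.form.star_ip]

noncomputable instance : Star X.adjointable where
  star T := ⟨X.adjOp T, T.1, X.adjOp_ip T⟩

theorem ip_star (T : X.adjointable) (x y : X) :
    X.ip (T.1 x) y = X.ip x ((star T).1 y) := X.ip_adjOp T x y

theorem star_eq_of_ip {T S : X.adjointable} (h : ∀ x y, X.ip (T.1 x) y = X.ip x (S.1 y)) :
    star T = S :=
  Subtype.ext <| ContinuousLinearMap.ext fun y => X.ext_ip fun x => by rw [← ip_star, h]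

noncomputable instance : StarRing X.adjointable where
  star_involutive T := X.star_eq_of_ip (X.adjOp_ip T)
  star_mul T S := X.star_eq_of_ip fun x y => by
    change X.ip (T.1 (S.1 x)) y = X.ip x ((star S).1 ((star T).1 y))
    rw [ip_star, ip_star]
  star_add T S := X.star_eq_of_ip fun x y => by
    change X.ip (T.1 x + S.1 x) y = X.ip x ((star T).1 y + (star S).1 y)
    rw [map_add, map_add, LinearMap.add_apply, ip_star, ip_star]

noncomputable instance : StarModule ℂ X.adjointable where
  star_smul c T := X.star_eq_of_ip fun x y => by
    change X.ip (c • T.1 x) y = X.ip x (star c • (star T).1 y)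
    rw [map_smulₛₗ, map_smul, LinearMap.smul_apply, ip_star]
    rfl

instance : CStarRing X.adjointable where
  norm_mul_self_le T := by
    have h : ‖T.1‖ ≤ √‖star T * T‖ := by
      refine ContinuousLinearMap.opNorm_le_bound _ (by positivity) fun x => ?_
      refine le_of_sq_le_sq ?_ (by positivity)
      rw [X.norm_sq, mul_pow,
        Real.sq_sqrt (show 0 ≤ ‖star T * T‖ from norm_nonneg (star T * T))]
      have h1 : X.form.ip (T.1 x) (T.1 x) = X.ip x ((star T * T).1 x) := X.ip_star T x (T.1 x)
      rw [h1]
      refine (X.norm_ip_le _ _).trans ?_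
      have := (star T * T).1.le_opNorm x
      have h2 : ‖(star T * T).1‖ = ‖star T * T‖ := rfl
      rw [h2] at this
      nlinarith [norm_nonneg x]
    have h2 : ‖T‖ ≤ √‖star T * T‖ := h
    calc ‖T‖ * ‖T‖ ≤ √‖star T * T‖ * √‖star T * T‖ := by gcongr
      _ = ‖star T * T‖ := Real.mul_self_sqrt (norm_nonneg _)

theorem isClosed_adjointable : IsClosed (X.adjointable : Set (X →L[ℂ] X)) := by
  refine IsSeqClosed.isClosed ?_
  intro T T₀ hT hlim
  let T' : ℕ → X.adjointable := fun n => ⟨T n, hT n⟩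
  have hc : CauchySeq fun n => (star (T' n)).1 := by
    have h1 := hlim.cauchySeq
    rw [Metric.cauchySeq_iff] at h1 ⊢
    intro ε hε
    obtain ⟨N, hN⟩ := h1 ε hε
    refine ⟨N, fun m hm n hn => lt_of_eq_of_lt ?_ (hN m hm n hn)⟩
    rw [dist_eq_norm, dist_eq_norm]
    have : ‖star (T' m - T' n)‖ = ‖T' m - T' n‖ := norm_star (T' m - T' n)
    rw [star_sub] at this
    exact this
  obtain ⟨S, hS⟩ := cauchySeq_tendsto_of_complete hc
  refine ⟨S, fun x y => ?_⟩
  have h1 : Filter.Tendsto (fun n => X.ip (T n x) y) Filter.atTop (nhds (X.ip (T₀ x) y)) :=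
    ((X.continuous_ip (ContinuousLinearMap.apply ℂ X x).continuous continuous_const).tendsto
      T₀).comp hlim
  have h2 : Filter.Tendsto (fun n => X.ip x ((star (T' n)).1 y)) Filter.atTop
      (nhds (X.ip x (S y))) :=
    ((X.continuous_ip continuous_const (ContinuousLinearMap.apply ℂ X y).continuous).tendsto
      S).comp hS
  refine tendsto_nhds_unique h1 (h2.congr fun n => ?_)
  exact (X.ip_star (T' n) x y).symm

instance : CompleteSpace X.adjointable := X.isClosed_adjointable.completeSpace_coe

/-- `ℒ(X_B)` is a C⋆-algebra. -/
noncomputable instance : CStarAlgebra X.adjointable where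

/-- The rank-one operator `Θ_{x,y} z = x · ⟨y, z⟩_B`. -/
noncomputable def theta (x y : X) : X.adjointable :=
  ⟨(X.ractL x).comp (X.ipL y), (X.ractL y).comp (X.ipL x), fun z t => by
    change X.ip (X.ract x (X.ip y z)) t = X.ip z (X.ract y (X.ip x t))
    rw [X.form.ract_ip, X.form.ip_ract, X.form.star_ip]⟩

theorem theta_apply (x y z : X) : (X.theta x y).1 z = X.ract x (X.ip y z) := rfl

theorem star_theta (x y : X) : star (X.theta x y) = X.theta y x :=
  X.star_eq_of_ip fun z t => by
    rw [theta_apply, theta_apply, X.form.ract_ip, X.form.ip_ract, X.form.star_ip]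

theorem theta_mul (x y z t : X) :
    X.theta x y * X.theta z t = X.theta (X.ract x (X.ip y z)) t := by
  refine Subtype.ext <| ContinuousLinearMap.ext fun s => ?_
  change X.ract x (X.ip y (X.ract z (X.ip t s))) = X.ract (X.ract x (X.ip y z)) (X.ip t s)
  rw [X.form.ip_ract, X.form.ract_mul]

/-- The linear span of the rank-one operators. -/
noncomputable def finiteRank : NonUnitalStarSubalgebra ℂ X.adjointable where
  toSubmodule := Submodule.span ℂ {T | ∃ x y, X.theta x y = T}
  mul_mem' := by
    intro S T hS hT
    refine Submodule.span_induction₂ (p := fun S T _ _ => S * T ∈ Submodule.span ℂ _)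
      ?_ ?_ ?_ ?_ ?_ ?_ ?_ hS hT
    · rintro _ _ ⟨x, y, rfl⟩ ⟨z, t, rfl⟩
      exact Submodule.subset_span ⟨_, _, (X.theta_mul x y z t).symm⟩
    · intro T _; rw [zero_mul]; exact zero_mem _
    · intro T _; rw [mul_zero]; exact zero_mem _
    · intro _ _ _ _ _ _ h h'; rw [add_mul]; exact add_mem h h'
    · intro _ _ _ _ _ _ h h'; rw [mul_add]; exact add_mem h h'
    · intro r _ _ _ _ h; rw [smul_mul_assoc]; exact Submodule.smul_mem _ r h
    · intro r _ _ _ _ h; rw [mul_smul_comm]; exact Submodule.smul_mem _ r h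
  star_mem' := by
    intro T hT
    refine Submodule.span_induction (p := fun T _ => star T ∈ Submodule.span ℂ _)
      ?_ ?_ ?_ ?_ hT
    · rintro _ ⟨x, y, rfl⟩
      exact Submodule.subset_span ⟨y, x, (X.star_theta x y).symm⟩
    · rw [star_zero]; exact zero_mem _
    · intro _ _ _ _ h h'; rw [star_add]; exact add_mem h h'
    · intro r _ _ h; rw [star_smul]; exact Submodule.smul_mem _ _ h

/-- The C⋆-algebra `𝒦(X_B)` of compact operators: the closed linear span of the rank-one
operators in `ℒ(X_B)`. -/
noncomputable def compacts : NonUnitalStarSubalgebra ℂ X.adjointable :=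
  X.finiteRank.topologicalClosure

noncomputable instance : NonUnitalCStarAlgebra X.compacts :=
  NonUnitalStarSubalgebra.nonUnitalCStarAlgebra X.compacts
    (h_closed := X.finiteRank.isClosed_topologicalClosure)

end HilbertCModule

/-! ### Nondegenerate homomorphisms as bimodules -/

namespace RightHilbertBimodule

open scoped MultiplierAlgebra

variable {A : Type u} {C : Type w} [NonUnitalCStarAlgebra A] [NonUnitalCStarAlgebra C]

/-- A homomorphism `φ : A → M(C)` is nondegenerate if `φ(A)C` spans a dense subspace of `C`. -/
def HomNondegenerate (φ : A →⋆ₙₐ[ℂ] 𝓜(ℂ, C)) : Prop :=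
  Dense (Submodule.span ℂ {c | ∃ a d, (φ a).fst d = c} : Set C)

/-- The left part of a double centralizer is right linear. -/
theorem fst_mul (m : 𝓜(ℂ, C)) (c d : C) : m.fst (c * d) = m.fst c * d := by
  refine sub_eq_zero.1 <| (CStarRing.star_mul_self_eq_zero_iff _).1 ?_
  rw [mul_sub, ← m.central, ← mul_assoc, ← mul_assoc, ← m.central, sub_self]

/-- The right-Hilbert `A`–`C` bimodule `C` with `⟨c, d⟩ = c⋆d` and `a · c = φ(a)c` given by a
nondegenerate homomorphism `φ : A → M(C)`. -/
noncomputable def ofHom (φ : A →⋆ₙₐ[ℂ] 𝓜(ℂ, C)) (hφ : HomNondegenerate φ) :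
    RightHilbertBimodule.{u, w, w} A C where
  carrier := C
  form :=
    { ract := LinearMap.mul ℂ C
      ip := (LinearMap.mul ℂ C) ∘ₛₗ (starLinearEquiv ℂ (A := C)).toLinearMap
      ract_mul x b c := (mul_assoc x b c).symm
      ip_ract x y b := (mul_assoc (star x) y b).symm
      star_ip x y := by
        change star (star x * y) = star y * x
        rw [star_mul, star_star]
      ip_self_pos x := ⟨x, rfl⟩ }
  norm_sq x := by
    change ‖x‖ ^ 2 = ‖star x * x‖
    rw [CStarRing.norm_star_mul_self, sq]
  lact :=
    { toFun a := (φ a).fst.toLinearMap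
      map_add' a b := by rw [map_add]; rfl
      map_smul' r a := by rw [map_smul]; rfl }
  lact_mul a b x := by
    change (φ (a * b)).fst x = (φ a).fst ((φ b).fst x)
    rw [map_mul]; rfl
  lact_ract a x b := by
    change (φ a).fst (x * b) = (φ a).fst x * b
    exact fst_mul (φ a) x b
  ip_lact a x y := by
    change star ((φ a).fst x) * y = star x * (φ (star a)).fst y
    rw [map_star, ← DoubleCentralizer.central, DoubleCentralizer.star_snd, star_star]
  full := by
    change Dense ((Submodule.span ℂ {b | ∃ x y : C, star x * y = b} : Submodule ℂ C) : Set C)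
    let _ := CStarAlgebra.spectralOrder C
    have _ := CStarAlgebra.spectralOrderedRing C
    have h : Submodule.span ℂ {b | ∃ x y : C, star x * y = b} = ⊤ := by
      rw [eq_top_iff, ← CStarAlgebra.span_nonneg (A := C)]
      refine Submodule.span_mono fun a ha => ?_
      obtain ⟨b, hb⟩ := CStarAlgebra.nonneg_iff_eq_star_mul_self.1 (show 0 ≤ a from ha)
      exact ⟨b, b, hb.symm⟩
    rw [h]
    exact dense_univ
  nondegenerate := hφ

end RightHilbertBimodule

namespace CStarMor

open scoped MultiplierAlgebra

/-- the morphism `[φ]` given by a nondegenerate homomorphism `φ : A → M(C)` -/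
noncomputable def ofHom {A : Type u} {C : Type w} [NonUnitalCStarAlgebra A]
    [NonUnitalCStarAlgebra C] (φ : A →⋆ₙₐ[ℂ] 𝓜(ℂ, C))
    (hφ : RightHilbertBimodule.HomNondegenerate φ) : CStarMor.{u, w, w} A C :=
  mk (RightHilbertBimodule.ofHom φ hφ)

end CStarMor

/-! ### Imprimitivity bimodules -/

namespace RightHilbertBimodule

variable {C : Type u} {B : Type v} [NonUnitalCStarAlgebra C] [NonUnitalCStarAlgebra B]

/-- A right-Hilbert `C`–`B` bimodule `Y` is an imprimitivity bimodule if it is also a full left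
Hilbert `C`-module: there is a `C`-valued inner product `lip`, linear in the first and
conjugate-linear in the second variable, positive definite and full, such that `Y` is complete in
the norm `‖lip x x‖^{1/2}`, with the two compatibility conditions
`lip x y · z = x · ⟨y, z⟩_B` and `lip (x · b) y = lip x (y · b⋆)`. -/
def IsImprimitivity (Y : RightHilbertBimodule.{u, v, w} C B) : Prop :=
  ∃ lip : Y.carrier →ₗ[ℂ] Y.carrier →ₗ⋆[ℂ] C,
    (∀ c x y, lip (Y.lact c x) y = c * lip x y) ∧
    (∀ x y, star (lip x y) = lip y x) ∧
    (∀ x, ∃ c, lip x x = star c * c) ∧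
    (∀ x, lip x x = 0 → x = 0) ∧
    (∀ s : ℕ → Y.carrier,
      (∀ ε : ℝ, 0 < ε → ∃ N, ∀ m ≥ N, ∀ n ≥ N, √‖lip (s m - s n) (s m - s n)‖ < ε) →
      ∃ x, ∀ ε : ℝ, 0 < ε → ∃ N, ∀ n ≥ N, √‖lip (s n - x) (s n - x)‖ < ε) ∧
    Dense (Submodule.span ℂ {c | ∃ x y, lip x y = c} : Set C) ∧
    (∀ x y z, Y.lact (lip x y) z = Y.form.ract x (Y.form.ip y z)) ∧
    (∀ x y b, lip (Y.form.ract x b) y = lip x (Y.form.ract y (star b)))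

end RightHilbertBimodule

/-!
A right-Hilbert bimodule `X` factors through `K = 𝒦(X_B)`. The action of `A` consists of adjointable
operators, and `K` is an ideal in `ℒ(X_B)`, so that `A` multiplies `K` from both sides: this is
`φ : A → M(K)` (`homMultiplier`). It is nondegenerate since `a · Θ_{x,y} = Θ_{a · x, y}` and `A · X`
spans a dense subspace of `X`.

The imprimitivity bimodule is `X` itself, with `K` acting by evaluation and with left inner product
`Θ_{x,y}` (`compactsBimodule`, `compactsBimodule_isImprimitivity`). Three analytic facts are needed.
The action of `K` is nondegenerate, because `X · B` is dense in `X` (an approximate unit of `B`) and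
`X` is full. The element `Θ_{x,x}` is positive in `K`, because `⟨z, Θ_{x,x} z⟩ = ⟨x, z⟩⋆⟨x, z⟩` and
positivity of a compact operator can be tested on vectors (`compacts_pos_of_ip_pos`). Finally
`‖Θ_{x,x}‖ = ‖x‖²`, so that the left and the right inner product define the same norm, which gives
definiteness and completeness.

The isomorphism `K ⊗_K X ≅ X` is evaluation `T ⊗ x ↦ T x`: it preserves inner products by
`⟨T x, S y⟩ = ⟨x, T⋆S y⟩`, and its range is dense by nondegeneracy, hence everything by completeness
(`nonempty_tensor_iso`).
-/

/-! ### Rank-one and compact operators -/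

/-- Completeness, for a function that agrees with the norm of a Banach space. -/
theorem exists_limit_of_norm_eq {E : Type*} [NormedAddCommGroup E] [CompleteSpace E]
    {p : E → ℝ} (hp : ∀ x, p x = ‖x‖) (s : ℕ → E)
    (hs : ∀ ε : ℝ, 0 < ε → ∃ N, ∀ m ≥ N, ∀ n ≥ N, p (s m - s n) < ε) :
    ∃ x, ∀ ε : ℝ, 0 < ε → ∃ N, ∀ n ≥ N, p (s n - x) < ε := by
  simp only [hp, ← dist_eq_norm] at hs ⊢
  obtain ⟨x, hx⟩ := cauchySeq_tendsto_of_complete (Metric.cauchySeq_iff.2 hs)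
  exact ⟨x, Metric.tendsto_atTop.1 hx⟩

namespace HilbertCModule

variable {B : Type v} [NonUnitalCStarAlgebra B] (X : HilbertCModule.{v, w} B)

theorem adjointable_ract (T : X.adjointable) (x : X) (b : B) :
    T.1 (X.ract x b) = X.ract (T.1 x) b := by
  refine X.ext_ip fun z => ?_
  rw [← star_star T, ← X.ip_star, X.form.ip_ract, X.form.ip_ract, X.ip_star]

theorem mul_theta (T : X.adjointable) (x y : X) : T * X.theta x y = X.theta (T.1 x) y :=
  Subtype.ext <| ContinuousLinearMap.ext fun z => X.adjointable_ract T x (X.ip y z)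

theorem theta_mem_compacts (x y : X) : X.theta x y ∈ X.compacts :=
  X.finiteRank.le_topologicalClosure (Submodule.subset_span ⟨x, y, rfl⟩)

/-- The rank-one operator `Θ_{x,y}` as an element of `𝒦(X_B)`. -/
noncomputable def thetaK (x y : X) : X.compacts := ⟨X.theta x y, X.theta_mem_compacts x y⟩

theorem compacts_ext {S T : X.compacts} (h : ∀ z, S.1.1 z = T.1.1 z) : S = T :=
  Subtype.ext <| Subtype.ext <| ContinuousLinearMap.ext h

theorem star_thetaK (x y : X) : star (X.thetaK x y) = X.thetaK y x :=
  Subtype.ext (X.star_theta x y)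

theorem thetaK_ract (x y : X) (b : B) :
    X.thetaK (X.ract x b) y = X.thetaK x (X.ract y (star b)) :=
  X.compacts_ext fun z => by
    change X.ract (X.ract x b) (X.ip y z) = X.ract x (X.ip (X.ract y (star b)) z)
    rw [X.form.ract_ip, star_star, X.form.ract_mul]

/-- The form `(x, y) ↦ Θ_{x,y}`, linear in the first and conjugate-linear in the second
variable. -/
noncomputable def thetaL : X →ₗ[ℂ] X →ₗ⋆[ℂ] X.compacts :=
  LinearMap.mk₂'ₛₗ (RingHom.id ℂ) (starRingEnd ℂ) X.thetaK
    (fun x x' y => X.compacts_ext fun z => by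
      change X.ract (x + x') _ = X.ract x _ + X.ract x' _
      rw [map_add]; rfl)
    (fun r x y => X.compacts_ext fun z => by
      change X.ract (r • x) _ = r • X.ract x _
      rw [map_smul]; rfl)
    (fun x y y' => X.compacts_ext fun z => by
      change X.ract x (X.ip (y + y') z) = X.ract x (X.ip y z) + X.ract x (X.ip y' z)
      rw [map_add, LinearMap.add_apply, map_add])
    (fun r x y => X.compacts_ext fun z => by
      change X.ract x (X.ip (r • y) z) = star r • X.ract x (X.ip y z)
      rw [map_smulₛₗ, LinearMap.smul_apply, map_smul]; rfl)

theorem dense_span_thetaK :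
    Dense (Submodule.span ℂ {k | ∃ x y, X.thetaK x y = k} : Set X.compacts) := by
  intro k
  rw [Topology.IsInducing.subtypeVal.closure_eq_preimage_closure_image]
  refine closure_mono ?_ k.2
  intro T hT
  refine Submodule.span_induction (p := fun T _ => T ∈ Subtype.val ''
    (Submodule.span ℂ {k | ∃ x y, X.thetaK x y = k} : Set X.compacts)) ?_ ?_ ?_ ?_ hT
  · rintro _ ⟨x, y, rfl⟩
    exact ⟨X.thetaK x y, Submodule.subset_span ⟨x, y, rfl⟩, rfl⟩
  · exact ⟨0, Submodule.zero_mem _, rfl⟩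
  · rintro _ _ _ _ ⟨s, hs, rfl⟩ ⟨t, ht, rfl⟩
    exact ⟨s + t, Submodule.add_mem _ hs ht, rfl⟩
  · rintro r _ _ ⟨s, hs, rfl⟩
    exact ⟨_, Submodule.smul_mem _ r hs, rfl⟩

theorem adjointable_mul_mem_compacts (T : X.adjointable) {S : X.adjointable}
    (hS : S ∈ X.compacts) : T * S ∈ X.compacts := by
  refine map_mem_closure (f := fun S => T * S) (t := X.finiteRank) (continuous_const_mul T) hS ?_
  intro S hS
  refine Submodule.span_induction (p := fun S _ => T * S ∈ X.finiteRank) ?_ ?_ ?_ ?_ hS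
  · rintro _ ⟨x, y, rfl⟩
    exact Submodule.subset_span ⟨_, _, (X.mul_theta T x y).symm⟩
  · rw [mul_zero]; exact zero_mem _
  · intro _ _ _ _ h h'; rw [mul_add]; exact add_mem h h'
  · intro r _ _ h; rw [mul_smul_comm]; exact SMulMemClass.smul_mem r h

theorem compacts_mul_mem_compacts (T : X.adjointable) {S : X.adjointable}
    (hS : S ∈ X.compacts) : S * T ∈ X.compacts := by
  rw [← star_star (S * T), star_mul]
  exact star_mem (X.adjointable_mul_mem_compacts _ (star_mem hS))

end HilbertCModule

/-! ### Density, norm and positivity in Hilbert modules -/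

namespace HilbertCModule

variable {B : Type v} [NonUnitalCStarAlgebra B] (X : HilbertCModule.{v, w} B)

/-- The elements `x · b` are dense, because `x · b → x` as `b` runs through an approximate unit
of `B`. -/
theorem mem_closure_ract (x : X) : x ∈ closure {z | ∃ b, X.ract x b = z} := by
  let _ := CStarAlgebra.spectralOrder B
  have _ := CStarAlgebra.spectralOrderedRing B
  have hl := CStarAlgebra.increasingApproximateUnit B
  set h := X.ip x x
  -- For `b = b⋆`, `⟨x - x · b, x - x · b⟩ = (h - b h) - (h - b h) b`, and `‖b‖ ≤ 1`.
  have hx : ∀ᶠ b in CStarAlgebra.approximateUnit B,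
      ‖x - X.ract x b‖ ^ 2 ≤ 2 * ‖h - b * h‖ := by
    filter_upwards [hl.eventually_star_eq, hl.eventually_norm] with b hb hb1
    have h1 : X.ip (x - X.ract x b) (x - X.ract x b) = (h - b * h) - (h - b * h) * b := by
      simp only [map_sub, LinearMap.sub_apply, X.form.ip_ract, X.form.ract_ip, hb, h, sub_mul]
    have h2 : ‖x - X.ract x b‖ ^ 2 = ‖(h - b * h) - (h - b * h) * b‖ := by
      rw [X.norm_sq, ← h1]
    rw [h2]
    have h3 := norm_sub_le (h - b * h) ((h - b * h) * b)
    have h4 := norm_mul_le (h - b * h) b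
    nlinarith [norm_nonneg (h - b * h)]
  have h0 : Filter.Tendsto (fun b => 2 * ‖h - b * h‖) (CStarAlgebra.approximateUnit B)
      (nhds 0) := by
    simpa using ((tendsto_const_nhds (x := h)).sub (hl.tendsto_mul_right h)).norm.const_mul 2
  rw [Metric.mem_closure_iff]
  intro ε hε
  obtain ⟨b, hb, hb'⟩ := (hx.and (h0.eventually_lt_const (pow_pos hε 2))).exists
  refine ⟨_, ⟨b, rfl⟩, ?_⟩
  rw [dist_eq_norm]
  exact lt_of_pow_lt_pow_left₀ 2 hε.le (hb.trans_lt hb')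

theorem norm_theta_le (x y : X) : ‖X.theta x y‖ ≤ ‖x‖ * ‖y‖ := by
  refine ContinuousLinearMap.opNorm_le_bound _ (by positivity) fun z => ?_
  refine (X.norm_ract_le x (X.ip y z)).trans ?_
  rw [mul_assoc]
  exact mul_le_mul_of_nonneg_left (X.norm_ip_le y z) (norm_nonneg x)

theorem norm_theta_self (x : X) : ‖X.theta x x‖ = ‖x‖ ^ 2 := by
  refine le_antisymm ((X.norm_theta_le x x).trans_eq (sq _).symm) ?_
  have h1 : X.ip x ((X.theta x x).1 x) = star (X.ip x x) * X.ip x x := by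
    rw [theta_apply, X.form.ip_ract, X.form.star_ip]
  have h2 : ‖X.ip x ((X.theta x x).1 x)‖ = ‖x‖ ^ 2 * ‖x‖ ^ 2 := by
    rw [h1, CStarRing.norm_star_mul_self, X.norm_sq]
  have h3 : ‖(X.theta x x).1 x‖ ≤ ‖X.theta x x‖ * ‖x‖ := (X.theta x x).1.le_opNorm x
  have h4 := X.norm_ip_le x ((X.theta x x).1 x)
  -- `‖x‖⁴ = ‖⟨x, Θ_{x,x} x⟩‖ ≤ ‖Θ_{x,x}‖ ‖x‖²`, and `‖x‖²` can be cancelled unless `x = 0`.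
  rcases (norm_nonneg x).eq_or_lt with h0 | h0
  · rw [← h0, zero_pow two_ne_zero]
    exact norm_nonneg (X.theta x x)
  · have : ‖x‖ ^ 2 * ‖x‖ ^ 2 ≤ ‖X.theta x x‖ * ‖x‖ ^ 2 := by nlinarith
    exact le_of_mul_le_mul_right this (by positivity)

theorem sqrt_norm_thetaK_self (x : X) : √‖X.thetaK x x‖ = ‖x‖ :=
  (congrArg Real.sqrt (X.norm_theta_self x)).trans (Real.sqrt_sq (norm_nonneg x))

/-- A compact operator `T` with `⟨z, T z⟩ ≥ 0` for all `z` is positive in `𝒦(X_B)`. -/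
theorem compacts_pos_of_ip_pos {T : X.compacts} (hT : star T = T)
    (h : ∀ z, ∃ b, X.ip z (T.1.1 z) = star b * b) : ∃ S : X.compacts, T = star S * S := by
  let _ := CStarAlgebra.spectralOrder B
  have _ := CStarAlgebra.spectralOrderedRing B
  -- If `N⋆TN = -S⋆S` then `⟨S z, S z⟩ = -⟨N z, T (N z)⟩` is both positive and negative.
  obtain ⟨N, S, hNS, hpos⟩ := RightHilbertBimodule.exists_conj_eq_neg (T := T) hT
  refine hpos (Subtype.ext <| Subtype.ext <| ContinuousLinearMap.ext fun z => ?_)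
  refine X.eq_zero_of_ip ?_
  have h1 : X.ip z ((star N * T * N).1.1 z) = X.ip (N.1.1 z) (T.1.1 (N.1.1 z)) :=
    (X.ip_star N.1 z (T.1.1 (N.1.1 z))).symm
  have h2 : X.ip z ((star S * S).1.1 z) = X.ip (S.1.1 z) (S.1.1 z) :=
    (X.ip_star S.1 z (S.1.1 z)).symm
  have h3 : X.ip z ((star N * T * N).1.1 z) = - X.ip z ((star S * S).1.1 z) := by
    rw [hNS]; exact map_neg (X.ip z) _
  obtain ⟨b, hb⟩ := h (N.1.1 z)
  obtain ⟨c, hc⟩ := X.form.ip_self_pos (S.1.1 z)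
  have h4 : 0 ≤ - X.ip (S.1.1 z) (S.1.1 z) := by
    rw [← h2, ← h3, h1, hb]; exact star_mul_self_nonneg b
  have h5 : 0 ≤ X.ip (S.1.1 z) (S.1.1 z) := by
    change X.ip _ _ = _ at hc
    rw [hc]; exact star_mul_self_nonneg c
  exact le_antisymm (neg_nonneg.1 h4) h5

/-- Positivity of `Θ_{x,x}`, since `⟨z, Θ_{x,x} z⟩ = ⟨x, z⟩⋆⟨x, z⟩`. -/
theorem thetaK_self_pos (x : X) : ∃ S : X.compacts, X.thetaK x x = star S * S :=
  X.compacts_pos_of_ip_pos (X.star_thetaK x x) fun z => ⟨X.ip x z, by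
    change X.ip z (X.ract x (X.ip x z)) = _
    rw [X.form.ip_ract, X.form.star_ip]⟩

/-! ### Adjointable operators as multipliers -/

open scoped MultiplierAlgebra

/-- Every adjointable operator multiplies the ideal `𝒦(X_B)` from both sides; this is the
canonical homomorphism `ℒ(X_B) → M(𝒦(X_B))`. -/
noncomputable def toMultiplier : X.adjointable →⋆ₙₐ[ℂ] 𝓜(ℂ, X.compacts) where
  toFun T :=
    { fst :=
        { toFun S := ⟨T * S.1, X.adjointable_mul_mem_compacts T S.2⟩
          map_add' S S' := Subtype.ext (mul_add T S.1 S'.1)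
          map_smul' r S := Subtype.ext (mul_smul_comm r T S.1)
          cont := ((continuous_const_mul T).comp continuous_subtype_val).subtype_mk _ }
      snd :=
        { toFun S := ⟨S.1 * T, X.compacts_mul_mem_compacts T S.2⟩
          map_add' S S' := Subtype.ext (add_mul S.1 S'.1 T)
          map_smul' r S := Subtype.ext (smul_mul_assoc r S.1 T)
          cont := ((continuous_mul_const T).comp continuous_subtype_val).subtype_mk _ }
      central := fun S S' => Subtype.ext (mul_assoc S.1 T S'.1) }
  map_smul' r T := by
    refine DoubleCentralizer.ext _ _ _ _ (Prod.ext ?_ ?_) <;>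
      refine ContinuousLinearMap.ext fun S => Subtype.ext ?_
    · exact smul_mul_assoc r T S.1
    · exact mul_smul_comm r S.1 T
  map_zero' := by
    refine DoubleCentralizer.ext _ _ _ _ (Prod.ext ?_ ?_) <;>
      refine ContinuousLinearMap.ext fun S => Subtype.ext ?_
    · exact zero_mul S.1
    · exact mul_zero S.1
  map_add' T T' := by
    refine DoubleCentralizer.ext _ _ _ _ (Prod.ext ?_ ?_) <;>
      refine ContinuousLinearMap.ext fun S => Subtype.ext ?_
    · exact add_mul T T' S.1
    · exact mul_add S.1 T T'
  map_mul' T T' := by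
    refine DoubleCentralizer.ext _ _ _ _ (Prod.ext ?_ ?_) <;>
      refine ContinuousLinearMap.ext fun S => Subtype.ext ?_
    · exact mul_assoc T T' S.1
    · exact (mul_assoc S.1 T T').symm
  map_star' T := by
    refine DoubleCentralizer.ext _ _ _ _ (Prod.ext ?_ ?_) <;>
      refine ContinuousLinearMap.ext fun S => Subtype.ext ?_
    · change star T * S.1 = star (star S.1 * T)
      rw [star_mul, star_star]
    · change S.1 * star T = star (T * star S.1)
      rw [star_mul, star_star]

end HilbertCModule

/-! ### Recognizing internal tensor products -/

namespace SemiHilbertForm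

variable {B : Type v} [NonUnitalCStarAlgebra B] {E : Type w} [AddCommGroup E] [Module ℂ E]
  (P : SemiHilbertForm B E)

/-- The completion of a semi-definite module is determined by any form-preserving map with dense
range to a Hilbert module. -/
theorem exists_hat_equiv (X : HilbertCModule.{v, w'} B) (m : E →ₗ[ℂ] X)
    (hm : ∀ s t, X.ip (m s) (m t) = P.ip s t) (hd : DenseRange m) :
    ∃ e : P.Hat ≃ₗᵢ[ℂ] X, ∀ s, e (P.emb s) = m s := by
  have hn : ∀ s, ‖m s‖ = ‖P.emb s‖ := fun s => by
    rw [norm_emb, ← X.seminorm_eq]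
    exact congrArg (fun b => √‖b‖) (hm s s)
  have hf : ∀ s, m.extendOfNorm P.emb (P.emb s) = m s :=
    LinearMap.extendOfNorm_eq P.denseRange_emb ⟨1, fun s => by rw [one_mul, hn]⟩
  let f : P.Hat →ₗᵢ[ℂ] X :=
    { toLinearMap := (m.extendOfNorm P.emb).toLinearMap
      norm_map' := P.hat_induction
        (isClosed_eq (m.extendOfNorm P.emb).continuous.norm continuous_norm)
        fun s => (congrArg norm (hf s)).trans (hn s) }
  have hs : Function.Surjective f := by
    rw [← Set.range_eq_univ, ← f.isometry.isClosedEmbedding.isClosed_range.closure_eq]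
    refine DenseRange.closure_range (hd.mono ?_)
    rintro _ ⟨s, rfl⟩
    exact ⟨P.emb s, hf s⟩
  exact ⟨LinearIsometryEquiv.ofSurjective f hs, hf⟩

end SemiHilbertForm

namespace RightHilbertBimodule

section TensorIso

variable {A : Type u} {B : Type v} {C : Type u'} [NonUnitalCStarAlgebra A]
  [NonUnitalCStarAlgebra B] [NonUnitalCStarAlgebra C]

open scoped TensorProduct

/-- A bimodule `Z` is isomorphic to the internal tensor product `X ⊗_B Y` as soon as it receives a
bilinear map from `X × Y` with dense span that has the inner products and the actions of
`X ⊗_B Y`. -/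
theorem nonempty_tensor_iso (X : RightHilbertBimodule.{u, v, w} A B)
    (Y : RightHilbertBimodule.{v, u', w} B C) (Z : RightHilbertBimodule.{u, u', w} A C)
    (m : X.carrier →ₗ[ℂ] Y.carrier →ₗ[ℂ] Z.carrier)
    (hip : ∀ x y x' y',
      Z.form.ip (m x y) (m x' y') = Y.form.ip y (Y.lact (X.form.ip x x') y'))
    (hl : ∀ a x y, m (X.lact a x) y = Z.lact a (m x y))
    (hr : ∀ x y c, m x (Y.form.ract y c) = Z.form.ract (m x y) c)
    (hd : Dense (Submodule.span ℂ {z | ∃ x y, m x y = z} : Set Z.carrier)) :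
    Nonempty ((X.tensor Y).Iso Z) := by
  set P := tensorForm X Y with hP
  let n : X.carrier ⊗[ℂ] Y.carrier →ₗ[ℂ] Z.carrier := TensorProduct.lift m
  have hn : ∀ x y, n (x ⊗ₜ y) = m x y := fun x y => TensorProduct.lift.tmul x y
  have hnip : ∀ s t, Z.form.ip (n s) (n t) = P.ip s t := by
    intro s t
    induction s with
    | zero => simp
    | add s s' hs ht => simp only [map_add, LinearMap.add_apply, hs, ht]
    | tmul x y =>
      induction t with
      | zero => simp
      | add s s' hs ht => simp only [map_add, hs, ht]
      | tmul x' y' => rw [hn, hn, hip]; rfl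
  have hnd : DenseRange n := by
    refine hd.mono ?_
    change _ ⊆ ((LinearMap.range n : Submodule ℂ Z.carrier) : Set Z.carrier)
    refine Submodule.span_le.2 ?_
    rintro _ ⟨x, y, rfl⟩
    exact ⟨x ⊗ₜ y, hn x y⟩
  obtain ⟨e, he⟩ := P.exists_hat_equiv Z.toHilbertCModule n hnip hnd
  exact ⟨{
    toLinearEquiv := e.toLinearEquiv
    map_lact a z := by
      refine P.hat_induction (p := fun z => e (hatLact X Y a z) = Z.lact a (e z))
        (isClosed_eq (e.continuous.comp (P.continuous_hatLact _ _ a))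
          (Z.continuous_lact continuous_const e.continuous)) (fun s => ?_) z
      rw [hatLact_emb, he, he]
      induction s with
      | zero => simp
      | add s s' hs ht => simp only [map_add, hs, ht]
      | tmul x y => rw [tensorLact_tmul, hn, hn, hl]
    map_ract z c := by
      refine P.hat_induction (p := fun z => e (P.hatRact z c) = Z.form.ract (e z) c)
        (isClosed_eq (e.continuous.comp (P.continuous_hatRact continuous_id continuous_const))
          (Z.toHilbertCModule.continuous_ract e.continuous continuous_const)) (fun s => ?_) z
      rw [SemiHilbertForm.hatRact_emb, he, he]
      induction s with
      | zero => simp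
      | add s s' hs ht => simp only [map_add, LinearMap.add_apply, hs, ht]
      | tmul x y =>
        rw [hn, ← hr, ← hn]; rfl
    map_ip z z' := by
      refine P.hat_induction (p := fun z => Z.form.ip (e z) (e z') = P.hatIp z z')
        (isClosed_eq (Z.toHilbertCModule.continuous_ip e.continuous continuous_const)
          (P.continuous_hatIp continuous_id continuous_const)) (fun s => ?_) z
      refine P.hat_induction
        (p := fun z' => Z.form.ip (e (P.emb s)) (e z') = P.hatIp (P.emb s) z')
        (isClosed_eq (Z.toHilbertCModule.continuous_ip continuous_const e.continuous)
          (P.continuous_hatIp continuous_const continuous_id)) (fun t => ?_) z'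
      rw [he, he, SemiHilbertForm.hatIp_emb, hnip] }⟩

end TensorIso

end RightHilbertBimodule

/-! ### The factorization through the compact operators -/

namespace RightHilbertBimodule

open scoped MultiplierAlgebra

variable {A : Type u} {B : Type v} [NonUnitalCStarAlgebra A] [NonUnitalCStarAlgebra B]
  (X : RightHilbertBimodule.{u, v, w} A B)

/-- The left action of a bimodule as a homomorphism `A → ℒ(X_B)`. -/
noncomputable def lactHom : A →⋆ₙₐ[ℂ] X.toHilbertCModule.adjointable where
  toFun a := ⟨X.lactL a, X.lactL (star a), X.ip_lact a⟩
  map_smul' r a := Subtype.ext (map_smul X.lactL r a)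
  map_zero' := Subtype.ext (map_zero X.lactL)
  map_add' a b := Subtype.ext (map_add X.lactL a b)
  map_mul' a b := Subtype.ext (ContinuousLinearMap.ext (X.lact_mul a b))
  map_star' a := (X.toHilbertCModule.star_eq_of_ip (X.ip_lact a)).symm

/-- The action of `A` on `𝒦(X_B)` by left multiplication with operators `x ↦ a · x`. -/
noncomputable def homMultiplier : A →⋆ₙₐ[ℂ] 𝓜(ℂ, X.toHilbertCModule.compacts) :=
  X.toHilbertCModule.toMultiplier.comp X.lactHom

/-- This follows from `a · Θ_{x,y} = Θ_{a · x, y}` and the nondegeneracy of `X`, by continuity of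
`x ↦ Θ_{x,y}`. -/
theorem homMultiplier_nondegenerate : HomNondegenerate X.homMultiplier := by
  set S := Submodule.span ℂ
    {c | ∃ a d, (X.homMultiplier a).fst d = c} with hS
  have key : ∀ x y : X.carrier, X.toHilbertCModule.thetaK x y ∈ S.topologicalClosure := by
    intro x y
    let f : X.carrier →L[ℂ] X.toHilbertCModule.compacts :=
      LinearMap.mkContinuous (X.toHilbertCModule.thetaL.flip y)
        ‖y‖ fun x => (X.toHilbertCModule.norm_theta_le x y).trans_eq (mul_comm _ _)
    refine mem_of_dense_span X.nondegenerate f S.topologicalClosure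
      S.isClosed_topologicalClosure ?_ x
    rintro _ ⟨a, x, rfl⟩
    refine S.le_topologicalClosure (Submodule.subset_span
      ⟨a, X.toHilbertCModule.thetaK x y, Subtype.ext ?_⟩)
    exact X.toHilbertCModule.mul_theta (X.lactHom a) x y
  intro T
  refine mem_of_dense_span X.toHilbertCModule.dense_span_thetaK
    (ContinuousLinearMap.id ℂ _) S.topologicalClosure S.isClosed_topologicalClosure ?_ T
  rintro _ ⟨x, y, rfl⟩
  exact key x y

/-- The Hilbert module `X_B` as a bimodule over `𝒦(X_B)`, acting by evaluation `T · x = T x`. -/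
noncomputable def compactsBimodule :
    RightHilbertBimodule.{w, v, w} X.toHilbertCModule.compacts B where
  toHilbertCModule := X.toHilbertCModule
  lact :=
    { toFun T := T.1.1.toLinearMap
      map_add' _ _ := rfl
      map_smul' _ _ := rfl }
  lact_mul _ _ _ := rfl
  lact_ract T x b := X.toHilbertCModule.adjointable_ract T.1 x b
  ip_lact T x y := X.toHilbertCModule.ip_star T.1 x y
  full := X.full
  nondegenerate := by
    -- `x · b` is a limit of sums of vectors `x · ⟨y, z⟩ = Θ_{x,y} z`, by fullness.
    set S := Submodule.span ℂ {z | ∃ (T : X.toHilbertCModule.compacts) (x : X.carrier),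
      T.1.1 x = z} with hS
    intro x
    change x ∈ S.topologicalClosure
    refine closure_minimal ?_ S.isClosed_topologicalClosure
      (X.toHilbertCModule.mem_closure_ract x)
    rintro _ ⟨b, rfl⟩
    refine mem_of_dense_span X.full (X.toHilbertCModule.ractL x) S.topologicalClosure
      S.isClosed_topologicalClosure ?_ b
    rintro _ ⟨y, z, rfl⟩
    exact S.le_topologicalClosure (Submodule.subset_span
      ⟨X.toHilbertCModule.thetaK x y, z, rfl⟩)

theorem compactsBimodule_isImprimitivity : X.compactsBimodule.IsImprimitivity := by
  refine ⟨X.toHilbertCModule.thetaL, fun T x y => ?_, X.toHilbertCModule.star_thetaK, fun x => ?_,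
    fun x hx => ?_, fun s hs => ?_, X.toHilbertCModule.dense_span_thetaK, fun _ _ _ => rfl,
    X.toHilbertCModule.thetaK_ract⟩
  · exact Subtype.ext (X.toHilbertCModule.mul_theta T.1 x y).symm
  · exact X.toHilbertCModule.thetaK_self_pos x
  · have h0 := congrArg (fun T => √‖T‖) hx
    exact norm_eq_zero.1 ((X.toHilbertCModule.sqrt_norm_thetaK_self x).symm.trans
      (h0.trans (by simp)))
  · exact exists_limit_of_norm_eq (E := X.carrier) X.toHilbertCModule.sqrt_norm_thetaK_self s hs

/-- The isomorphism `𝒦(X_B) ⊗ X ≅ X` induced by evaluation. -/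
theorem nonempty_iso_tensor_compacts : Nonempty
    (X.Iso ((ofHom X.homMultiplier X.homMultiplier_nondegenerate).tensor X.compactsBimodule)) := by
  obtain ⟨f⟩ := nonempty_tensor_iso (ofHom X.homMultiplier X.homMultiplier_nondegenerate)
    X.compactsBimodule X X.compactsBimodule.lact
    -- `⟨T x, S y⟩ = ⟨x, T⋆ (S y)⟩`, where `T⋆ S` is the inner product of `T` and `S` in `K`.
    (fun T x S y => X.toHilbertCModule.ip_star (show X.toHilbertCModule.compacts from T).1 x
      ((show X.toHilbertCModule.compacts from S).1.1 y))
    (fun a T x => rfl) X.compactsBimodule.lact_ract X.compactsBimodule.nondegenerate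
  exact ⟨f.symm⟩

end RightHilbertBimodule

open scoped MultiplierAlgebra in
theorem proposition2p8 {A : Type u} {B : Type v} [NonUnitalCStarAlgebra A]
    [NonUnitalCStarAlgebra B] :
    (∀ f : CStarMor.{u, v, w} A B,
      ∃ (C : Type w) (_ : NonUnitalCStarAlgebra C) (φ : A →⋆ₙₐ[ℂ] 𝓜(ℂ, C))
        (hφ : RightHilbertBimodule.HomNondegenerate φ) (Y : RightHilbertBimodule.{w, v, w} C B),
        Y.IsImprimitivity ∧ f = (CStarMor.mk Y).comp (CStarMor.ofHom φ hφ)) ∧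
    (∀ X : RightHilbertBimodule.{u, v, w} A B,
      ∃ (φ : A →⋆ₙₐ[ℂ] 𝓜(ℂ, X.toHilbertCModule.compacts))
        (hφ : RightHilbertBimodule.HomNondegenerate φ)
        (Y : RightHilbertBimodule.{w, v, w} X.toHilbertCModule.compacts B),
        Y.IsImprimitivity ∧
        CStarMor.mk X = (CStarMor.mk Y).comp (CStarMor.ofHom φ hφ) ∧
        Nonempty (X.Iso ((RightHilbertBimodule.ofHom φ hφ).tensor Y))) := by
  have key : ∀ X : RightHilbertBimodule.{u, v, w} A B,
      CStarMor.mk X = (CStarMor.mk X.compactsBimodule).comp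
        (CStarMor.ofHom X.homMultiplier X.homMultiplier_nondegenerate) :=
    fun X => Quotient.sound X.nonempty_iso_tensor_compacts
  refine ⟨fun f => ?_, fun X => ⟨X.homMultiplier, X.homMultiplier_nondegenerate,
    X.compactsBimodule, X.compactsBimodule_isImprimitivity, key X,
    X.nonempty_iso_tensor_compacts⟩⟩
  induction f using Quotient.ind with
  | _ X => exact ⟨_, _, X.homMultiplier, X.homMultiplier_nondegenerate, X.compactsBimodule,
      X.compactsBimodule_isImprimitivity, key X⟩
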